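/- Let $P\subset\mathbb R^2$ be an orthogonal polygon, i.e. a nonempty finite union of non-degenerate closed axis-parallel rectangles whose boundary $\delta P$ consists of pairwise disjoint simple closed rectilinear curves (holes and several components are allowed). Its edges are the maximal segments contained in $\delta P$. Let $k,m\ge 0$ be integers. A sliding $k$-transmitter is a non-degenerate horizontal or vertical segment $s\subseteq P$ (it may run along edges). It sees a point $p\in P$ if the perpendicular from $p$ onto the line of $s$ ends at a point $q\in s$ and the segment $\overline{pq}$ crosses $\delta P$ at most $k$ times. Here each passage of $\overline{pq}$ through the exterior of $P$ counts as two crossings (leaving and entering $P$), and touching $\delta P$ or running along it without changing sides is not a crossing; precisely, the number of crossings is $2r$ for the largest $r$ such that $\overline{pq}$ contains $r$ points outside $P$ any two of which are separated on $\overline{pq}$ by an interior point of $P$. A set of transmitters guards $P$ if every point of $P$ is seen by one of them. To extend a horizontal segment $s$ means to expand it to the left and to the right, on each side until a vertical edge is hit from the strict inside of $P$ for the $(\lfloor k/2\rfloor+1)$st time, stopping at the last such hit if there are fewer (and not expanding at all if there is none). The horizontal partition-segments are the extensions of the horizontal edges of $P$; they split the interior of $P$ into open rectangles, the horizontal slices.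 For each horizontal slice $\sigma$ fix any horizontal segment inside $\sigma$; its extension is the slice-segment of $\sigma$. Vertical slices and slice-segments are defined analogously. A pixel is a nonempty intersection $\sigma_H\cap\sigma_V$ of a horizontal and a vertical slice; its cross is the point where the slice-segments of $\sigma_H$ and $\sigma_V$, which are said to support the cross, intersect. A guard-segment is a maximal horizontal or vertical segment contained in $P$ that contains an edge of $P$. A guard-segment $g$ hits a cross if it meets the slice-segment supporting the cross that is perpendicular to $g$. Then, for every choice of the segments that define the slice-segments, the following are equivalent: 1. there is a set of at most $m$ sliding $k$-transmitters that guards $P$; 2. there is a set of at most $m$ guard-segments such that every cross is hit by some guard-segment of the set. -/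

import Mathlib

namespace SlidingTransmitter

/-- The two axis-parallel directions. -/
inductive Dir
  | horizontal
  | vertical

/-- The perpendicular direction. -/
def Dir.perp : Dir → Dir
  | .horizontal => .vertical
  | .vertical => .horizontal

/-- The point with coordinate `t` on the line of direction `d` at level `c`: the line `y = c` if
`d` is horizontal, the line `x = c` if `d` is vertical. -/
def pt : Dir → ℝ → ℝ → ℝ × ℝ
  | .horizontal, c, t => (t, c)
  | .vertical, c, t => (c, t)

/-- The coordinate of a point that varies along direction `d`. -/
def coord : Dir → ℝ × ℝ → ℝ
  | .horizontal, p => p.1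
  | .vertical, p => p.2

/-- A non-degenerate horizontal or vertical line segment. -/
@[ext]
structure Seg where
  dir : Dir
  level : ℝ
  lo : ℝ
  hi : ℝ
  lo_lt_hi : lo < hi

/-- The set of points of a segment (endpoints included). -/
def Seg.carrier (s : Seg) : Set (ℝ × ℝ) := pt s.dir s.level '' Set.Icc s.lo s.hi

/-- An orthogonal polygon, as a closed region of the plane: a finite union of non-degenerate
closed axis-parallel rectangles (`Set.Icc a b` is the rectangle with lower left corner `a` and upper
right corner `b`) whose boundary does not touch itself, so that the boundary consists of pairwise
disjoint simple closed rectilinear curves.  Holes are allowed, and so are several components. -/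
structure IsOrthogonalPolygon (P : Set (ℝ × ℝ)) : Prop where
  nonempty : P.Nonempty
  finite_union : ∃ F : Finset ((ℝ × ℝ) × (ℝ × ℝ)),
    (∀ r ∈ F, r.1.1 < r.2.1 ∧ r.1.2 < r.2.2) ∧ P = ⋃ r ∈ F, Set.Icc r.1 r.2
  no_pinch : ∀ x y ε : ℝ, 0 < ε →
    ¬ (Set.Ioo x (x + ε) ×ˢ Set.Ioo y (y + ε) ⊆ P ∧
       Set.Ioo (x - ε) x ×ˢ Set.Ioo (y - ε) y ⊆ P ∧
       Disjoint (Set.Ioo (x - ε) x ×ˢ Set.Ioo y (y + ε)) P ∧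
       Disjoint (Set.Ioo x (x + ε) ×ˢ Set.Ioo (y - ε) y) P)
  no_pinch' : ∀ x y ε : ℝ, 0 < ε →
    ¬ (Disjoint (Set.Ioo x (x + ε) ×ˢ Set.Ioo y (y + ε)) P ∧
       Disjoint (Set.Ioo (x - ε) x ×ˢ Set.Ioo (y - ε) y) P ∧
       Set.Ioo (x - ε) x ×ˢ Set.Ioo y (y + ε) ⊆ P ∧
       Set.Ioo x (x + ε) ×ˢ Set.Ioo (y - ε) y ⊆ P)

/-- An edge of `P`: a maximal segment contained in the boundary. -/
def IsEdge (P : Set (ℝ × ℝ)) (e : Seg) : Prop :=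
  e.carrier ⊆ frontier P ∧ ∀ s : Seg, s.carrier ⊆ frontier P → e.carrier ⊆ s.carrier → s = e

/-- The carrier of a sliding transmitter: a horizontal or vertical segment in `P`
(it may run along the boundary). -/
def IsTransmitter (P : Set (ℝ × ℝ)) (s : Seg) : Prop := s.carrier ⊆ P

/-- The segment from `p` to `q` passes through the exterior of `P` at least `r` times: it contains,
in this order, `r` points outside `P`, any two of which are separated on the segment by an interior
point of `P`. -/
def HasExteriorPassages (P : Set (ℝ × ℝ)) (p q : ℝ × ℝ) (r : ℕ) : Prop :=
  ∃ t : Fin r → ℝ,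
    (∀ i, t i ∈ Set.Icc (0 : ℝ) 1 ∧ AffineMap.lineMap p q (t i) ∉ P) ∧
    ∀ i j, i < j → ∃ u, t i < u ∧ u < t j ∧ AffineMap.lineMap p q u ∈ interior P

/-- The number of times the segment between two points `p`, `q` of `P` crosses the boundary of `P`.
Each passage through the exterior consists of two crossings (leaving `P` and entering `P`).
Touching the boundary, or running along it, without changing sides is not a crossing. -/
noncomputable def crossings (P : Set (ℝ × ℝ)) (p q : ℝ × ℝ) : ℕ∞ :=
  ⨆ (r : ℕ) (_ : HasExteriorPassages P p q r), ((2 * r : ℕ) : ℕ∞)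

/-- The sliding `k`-transmitter `s` sees `p`: the perpendicular from `p` onto the line of `s` ends on
`s` and crosses the boundary of `P` at most `k` times. -/
def Sees (P : Set (ℝ × ℝ)) (k : ℕ) (s : Seg) (p : ℝ × ℝ) : Prop :=
  coord s.dir p ∈ Set.Icc s.lo s.hi ∧ crossings P p (pt s.dir s.level (coord s.dir p)) ≤ k

/-- The set `S` of sliding `k`-transmitters guards `P`. -/
def Guards (P : Set (ℝ × ℝ)) (k : ℕ) (S : Finset Seg) : Prop :=
  ∀ p ∈ P, ∃ s ∈ S, Sees P k s p

/-- Moving along the line of direction `d` at level `c` in increasing direction, one hits at `t` the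
boundary coming from the strict inside of `P` (hence one hits an edge perpendicular to `d`). -/
def HitFwd (P : Set (ℝ × ℝ)) (d : Dir) (c t : ℝ) : Prop :=
  pt d c t ∈ frontier P ∧ ∃ a < t, ∀ u ∈ Set.Ioo a t, pt d c u ∈ interior P

/-- The same when moving in decreasing direction. -/
def HitBwd (P : Set (ℝ × ℝ)) (d : Dir) (c t : ℝ) : Prop :=
  pt d c t ∈ frontier P ∧ ∃ b > t, ∀ u ∈ Set.Ioo t b, pt d c u ∈ interior P

/-- `h` is one of the first `⌊k/2⌋ + 1` hits from the inside after `b` in increasing direction. -/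
def ReachFwd (P : Set (ℝ × ℝ)) (k : ℕ) (d : Dir) (c b h : ℝ) : Prop :=
  b < h ∧ HitFwd P d c h ∧
    {u | b < u ∧ u < h ∧ HitFwd P d c u}.encard < ((k / 2 + 1 : ℕ) : ℕ∞)

/-- `h` is one of the first `⌊k/2⌋ + 1` hits from the inside after `a` in decreasing direction. -/
def ReachBwd (P : Set (ℝ × ℝ)) (k : ℕ) (d : Dir) (c a h : ℝ) : Prop :=
  h < a ∧ HitBwd P d c h ∧
    {u | h < u ∧ u < a ∧ HitBwd P d c u}.encard < ((k / 2 + 1 : ℕ) : ℕ∞)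

/-- The segment obtained by expanding `s` on both sides until a perpendicular edge is hit from the
strict inside of `P` for the `(⌊k/2⌋ + 1)`st time; if there are not enough such hits, the expansion
stops at the last one. -/
def extension (P : Set (ℝ × ℝ)) (k : ℕ) (s : Seg) : Set (ℝ × ℝ) :=
  {p | ∃ a b : ℝ, (a = s.lo ∨ ReachBwd P k s.dir s.level s.lo a) ∧
    (b = s.hi ∨ ReachFwd P k s.dir s.level s.hi b) ∧ p ∈ pt s.dir s.level '' Set.Icc a b}

/-- The interior of `P` without the partition-segments of direction `d`, which are the extensions of
the edges of direction `d`. -/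
def cutInterior (P : Set (ℝ × ℝ)) (k : ℕ) (d : Dir) : Set (ℝ × ℝ) :=
  interior P \ ⋃ (e : Seg) (_ : IsEdge P e ∧ e.dir = d), extension P k e

/-- A slice of direction `d` (an open rectangle): one of the parts into which the partition-segments
of direction `d` split the interior of `P`. -/
def IsSlice (P : Set (ℝ × ℝ)) (k : ℕ) (d : Dir) (σ : Set (ℝ × ℝ)) : Prop :=
  ∃ z ∈ cutInterior P k d, σ = connectedComponentIn (cutInterior P k d) z

/-- `rep` selects in every slice of direction `d` a segment of direction `d` strictly inside. The
slice-segment of the slice `σ` is then `extension P k (rep d σ)`. -/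
def IsSelection (P : Set (ℝ × ℝ)) (k : ℕ) (rep : Dir → Set (ℝ × ℝ) → Seg) : Prop :=
  ∀ d σ, IsSlice P k d σ → (rep d σ).dir = d ∧ (rep d σ).carrier ⊆ σ

/-- A guard-segment: a segment obtained from an edge by extending it inside `P` as far as
possible. -/
def IsGuardSegment (P : Set (ℝ × ℝ)) (g : Seg) : Prop :=
  (∃ e, IsEdge P e ∧ e.carrier ⊆ g.carrier) ∧ g.carrier ⊆ P ∧
    ∀ s : Seg, s.carrier ⊆ P → g.carrier ⊆ s.carrier → s = g

/-- A cross: the point where the slice-segments of a horizontal and a vertical slice that form a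
pixel (i.e. that intersect) meet. -/
structure Cross (P : Set (ℝ × ℝ)) (k : ℕ) (rep : Dir → Set (ℝ × ℝ) → Seg) where
  slice : Dir → Set (ℝ × ℝ)
  isSlice : ∀ d, IsSlice P k d (slice d)
  pixel_nonempty : (slice .horizontal ∩ slice .vertical).Nonempty
  point : ℝ × ℝ
  point_mem : ∀ d, point ∈ extension P k (rep d (slice d))

/-- The slice-segment of direction `d` that supports a cross. -/
def Cross.support {P : Set (ℝ × ℝ)} {k : ℕ} {rep : Dir → Set (ℝ × ℝ) → Seg}
    (c : Cross P k rep) (d : Dir) : Set (ℝ × ℝ) :=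
  extension P k (rep d (c.slice d))

/-- The cross `c` is hit by `g`: `g` meets the supporting slice-segment perpendicular to `g`. -/
def Cross.HitBy {P : Set (ℝ × ℝ)} {k : ℕ} {rep : Dir → Set (ℝ × ℝ) → Seg}
    (c : Cross P k rep) (g : Seg) : Prop :=
  (g.carrier ∩ c.support g.dir.perp).Nonempty

end SlidingTransmitter

namespace SlidingTransmitter

open Set Filter Topology

/-!
A transmitter can be shifted perpendicularly to itself inside `P` until part of it runs along an
edge, and then enlarged to a guard-segment. It still sees all that it saw, since the feet of the
perpendiculars have only moved inside `P`. Hence guard-segments suffice.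

Which part of the line of direction `d` through a point `z` is visible from `z` depends only on the
slice of direction `d` containing `z`. For this to change at `z`, the traces of `P` on the parallels
on the two sides of the line must differ. Where they differ for the first time on the way from `z`,
an edge of direction `d` runs along the line. The extension of this edge does not reach `z`, so the
line has left the interior of `P` at least `⌊k / 2⌋ + 1` times in between, and nothing beyond that
is visible anyway. Seen from the segment of a slice, the visible points of `P` are those of the
slice-segment. By maximality, a guard-segment therefore sees one point of a perpendicular slice if
and only if it sees all of them, if and only if it meets the slice-segment.

Finally, the points that lie in slices of both directions are dense in `P`, and the set of points
seen is closed.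
-/

/-! ### Step functions and tame sets -/

/-- The function `f` is locally constant on both sides of `c`, with value `U` just above and `L`
just below, and its value at `c` is their supremum. The traces of a closed polygon on parallel lines
behave like this, and so does the membership in a finite union of non-degenerate closed
intervals. -/
structure IsStepAt {α : Type*} [Max α] (f : ℝ → α) (c : ℝ) (U L : α) : Prop where
  above : ∀ᶠ x in 𝓝[>] c, f x = U
  below : ∀ᶠ x in 𝓝[<] c, f x = L
  value : f c = U ⊔ L

namespace IsStepAt

variable {α β : Type*} [SemilatticeSup α] [SemilatticeSup β] {f g : ℝ → α} {c : ℝ} {U L U' L' : α}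

lemma const (a : α) (c : ℝ) : IsStepAt (fun _ => a) c a a :=
  ⟨.of_forall fun _ => rfl, .of_forall fun _ => rfl, (sup_idem a).symm⟩

lemma sup (hf : IsStepAt f c U L) (hg : IsStepAt g c U' L') :
    IsStepAt (f ⊔ g) c (U ⊔ U') (L ⊔ L') where
  above := by filter_upwards [hf.above, hg.above] with x h h' using congrArg₂ _ h h'
  below := by filter_upwards [hf.below, hg.below] with x h h' using congrArg₂ _ h h'
  value := by rw [Pi.sup_apply, hf.value, hg.value, sup_sup_sup_comm]

lemma map (hf : IsStepAt f c U L) (φ : SupHom α β) : IsStepAt (φ ∘ f) c (φ U) (φ L) where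
  above := hf.above.mono fun _ => congrArg φ
  below := hf.below.mono fun _ => congrArg φ
  value := (congrArg φ hf.value).trans (φ.map_sup' U L)

lemma comp_neg (hf : IsStepAt f (-c) U L) : IsStepAt (fun x => f (-x)) c L U where
  above := tendsto_neg_nhdsGT.eventually hf.below
  below := tendsto_neg_nhdsLT.eventually hf.above
  value := by rw [hf.value, sup_comm]

lemma mem_Icc {a b : ℝ} (hab : a < b) (c : ℝ) :
    IsStepAt (· ∈ Icc a b) c (c ∈ Ico a b) (c ∈ Ioc a b) where
  above := by
    have hle : ∀ᶠ x in 𝓝[>] c, a ≤ x ↔ a ≤ c := by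
      rcases le_or_gt a c with h | h
      · filter_upwards [self_mem_nhdsWithin] with x hx using iff_of_true (h.trans (le_of_lt hx)) h
      · filter_upwards [Ioo_mem_nhdsGT h] with x hx using iff_of_false hx.2.not_ge h.not_ge
    have hlt : ∀ᶠ x in 𝓝[>] c, x ≤ b ↔ c < b := by
      rcases lt_or_ge c b with h | h
      · filter_upwards [Ioo_mem_nhdsGT h] with x hx using iff_of_true hx.2.le h
      · filter_upwards [self_mem_nhdsWithin] with x hx
          using iff_of_false (h.trans_lt hx).not_ge h.not_gt
    filter_upwards [hle, hlt] with x h h' using propext (and_congr h h')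
  below := by
    have hle : ∀ᶠ x in 𝓝[<] c, x ≤ b ↔ c ≤ b := by
      rcases le_or_gt c b with h | h
      · filter_upwards [self_mem_nhdsWithin] with x hx using iff_of_true ((le_of_lt hx).trans h) h
      · filter_upwards [Ioo_mem_nhdsLT h] with x hx using iff_of_false hx.1.not_ge h.not_ge
    have hlt : ∀ᶠ x in 𝓝[<] c, a ≤ x ↔ a < c := by
      rcases lt_or_ge a c with h | h
      · filter_upwards [Ioo_mem_nhdsLT h] with x hx using iff_of_true hx.1.le h
      · filter_upwards [self_mem_nhdsWithin] with x hx
          using iff_of_false (LT.lt.trans_le hx h).not_ge h.not_gt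
    filter_upwards [hle, hlt] with x h h' using propext (and_congr h' h)
  value := propext (by simp only [Set.mem_Icc, mem_Ico, mem_Ioc, sup_Prop_eq]; grind)

end IsStepAt

/-- A compact set of reals that locally looks like a finite union of non-degenerate closed
intervals. -/
structure Tame (S : Set ℝ) : Prop where
  isCompact : IsCompact S
  exists_isStepAt : ∀ t, ∃ q q' : Prop, IsStepAt (· ∈ S) t q q'

namespace Tame

variable {S T : Set ℝ}

lemma empty : Tame ∅ := ⟨isCompact_empty, fun t => ⟨False, False, .const _ t⟩⟩

lemma Icc {a b : ℝ} (hab : a < b) : Tame (Icc a b) :=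
  ⟨isCompact_Icc, fun t => ⟨_, _, .mem_Icc hab t⟩⟩

lemma union (hS : Tame S) (hT : Tame T) : Tame (S ∪ T) := by
  refine ⟨hS.isCompact.union hT.isCompact, fun t => ?_⟩
  obtain ⟨_, _, hSt⟩ := hS.exists_isStepAt t
  obtain ⟨_, _, hTt⟩ := hT.exists_isStepAt t
  exact ⟨_, _, hSt.sup hTt⟩

lemma neg (hS : Tame S) : Tame (-S) := by
  refine ⟨hS.isCompact.neg, fun t => ?_⟩
  obtain ⟨_, _, h⟩ := hS.exists_isStepAt (-t)
  exact ⟨_, _, h.comp_neg⟩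

lemma eventually_nhdsGT (hS : Tame S) (t : ℝ) :
    (∀ᶠ u in 𝓝[>] t, u ∈ S) ∨ ∀ᶠ u in 𝓝[>] t, u ∉ S := by
  obtain ⟨q, _, h⟩ := hS.exists_isStepAt t
  exact (em q).imp (fun hq => h.above.mono fun _ hu => hu.mpr hq)
    fun hq => h.above.mono fun _ hu hmem => hq (hu.mp hmem)

lemma eventually_nhdsLT (hS : Tame S) (t : ℝ) :
    (∀ᶠ u in 𝓝[<] t, u ∈ S) ∨ ∀ᶠ u in 𝓝[<] t, u ∉ S := by
  obtain ⟨_, q, h⟩ := hS.exists_isStepAt t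
  exact (em q).imp (fun hq => h.below.mono fun _ hu => hu.mpr hq)
    fun hq => h.below.mono fun _ hu hmem => hq (hu.mp hmem)

lemma eventually_or_eventually_of_mem (hS : Tame S) {t : ℝ} (ht : t ∈ S) :
    (∀ᶠ u in 𝓝[>] t, u ∈ S) ∨ ∀ᶠ u in 𝓝[<] t, u ∈ S := by
  obtain ⟨q, q', h⟩ := hS.exists_isStepAt t
  exact (h.value.mp ht).imp (fun hq => h.above.mono fun _ hu => hu.mpr hq)
    fun hq => h.below.mono fun _ hu => hu.mpr hq

lemma mem_iff_frequently (hS : Tame S) {t : ℝ} : t ∈ S ↔ ∃ᶠ u in 𝓝[≠] t, u ∈ S := by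
  refine ⟨fun ht => ?_, fun h => ?_⟩
  · rcases hS.eventually_or_eventually_of_mem ht with h | h
    · exact h.frequently.filter_mono (nhdsGT_le_nhdsNE t)
    · exact h.frequently.filter_mono (nhdsLT_le_nhdsNE t)
  · exact hS.isCompact.isClosed.mem_of_frequently_of_tendsto h
      (tendsto_id.mono_left nhdsWithin_le_nhds)

end Tame

/-! ### Maximal intervals -/

/-- `[a, b]` is a maximal interval contained in `K`; the edges and the guard-segments of a polygon
are such intervals on its traces. -/
def IsMaxIcc (K : Set ℝ) (a b : ℝ) : Prop :=
  Icc a b ⊆ K ∧ ∀ a' b', a' ≤ a → b ≤ b' → Icc a' b' ⊆ K → a' = a ∧ b' = b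

lemma exists_isMaxIcc {K : Set ℝ} (hK : IsCompact K) {a b : ℝ} (hab : a ≤ b) (h : Icc a b ⊆ K) :
    ∃ a' b', IsMaxIcc K a' b' ∧ Icc a b ⊆ Icc a' b' := by
  set C := connectedComponentIn K a
  have hCK : C ⊆ K := connectedComponentIn_subset K a
  have haC : a ∈ C := mem_connectedComponentIn (h (left_mem_Icc.2 hab))
  have hCpre : IsPreconnected C := isPreconnected_connectedComponentIn
  have hCclosed : IsClosed C := isClosed_of_closure_subset <|
    hCpre.closure.subset_connectedComponentIn (subset_closure haC)
      (closure_minimal hCK hK.isClosed)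
  have hCIcc : C = Icc (sInf C) (sSup C) :=
    eq_Icc_of_connected_compact ⟨⟨a, haC⟩, hCpre⟩ (hK.of_isClosed_subset hCclosed hCK)
  have absorb {a' b'} (ha' : a' ≤ a) (hb' : b ≤ b') (hs : Icc a' b' ⊆ K) :
      Icc a' b' ⊆ Icc (sInf C) (sSup C) :=
    hCIcc ▸ isPreconnected_Icc.subset_connectedComponentIn ⟨ha', hab.trans hb'⟩ hs
  have hsub : Icc a b ⊆ Icc (sInf C) (sSup C) := absorb le_rfl le_rfl h
  obtain ⟨hlo, hhi⟩ := (Icc_subset_Icc_iff hab).1 hsub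
  refine ⟨sInf C, sSup C, ⟨hCIcc ▸ hCK, fun a' b' ha' hb' hs => ?_⟩, hsub⟩
  obtain ⟨hlo', hhi'⟩ := (Icc_subset_Icc_iff (ha'.trans (by linarith))).1
    (absorb (ha'.trans hlo) (hhi.trans hb') hs)
  exact ⟨le_antisymm ha' hlo', le_antisymm hhi' hb'⟩

lemma isMaxIcc_neg {K : Set ℝ} {a b : ℝ} : IsMaxIcc (-K) a b ↔ IsMaxIcc K (-b) (-a) := by
  have hsub {a b : ℝ} : Icc a b ⊆ -K ↔ Icc (-b) (-a) ⊆ K := by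
    rw [← neg_subset_neg, neg_neg, neg_Icc]
  refine and_congr hsub ⟨fun h a' b' ha hb hs => ?_, fun h a' b' ha hb hs => ?_⟩
  · have := h (-b') (-a') (by linarith) (by linarith) (hsub.2 (by simpa only [neg_neg] using hs))
    exact ⟨by linarith, by linarith⟩
  · have := h (-b') (-a') (by linarith) (by linarith) (hsub.1 hs)
    exact ⟨by linarith, by linarith⟩

lemma IsMaxIcc.mem_of_uIcc_subset {K : Set ℝ} {a b x y : ℝ} (h : IsMaxIcc K a b)
    (hx : x ∈ Icc a b) (hs : uIcc x y ⊆ K) : y ∈ Icc a b := by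
  obtain ⟨hmin, hmax⟩ := h.2 (min a y) (max b y) (min_le_left _ _) (le_max_left _ _) fun u hu => by
    by_cases hu' : u ∈ Icc a b
    · exact h.1 hu'
    · refine hs (mem_uIcc.2 ?_)
      simp only [mem_Icc, inf_le_iff, le_sup_iff] at hu hu' hx
      grind
  exact ⟨inf_eq_left.1 hmin, sup_eq_left.1 hmax⟩

/-! ### Passages through the exterior -/

/-- The segment from `p` to `q` contains at least `n` points outside `A` any two of which are
separated by a point of `B`. For a polygon `A` with interior `B` these are the passages of the
segment through the exterior of the polygon. -/
def Passages {V : Type*} [AddCommGroup V] [Module ℝ V] (A B : Set V) (p q : V) (n : ℕ) : Prop :=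
  ∃ E ⊆ segment ℝ p q \ A,
    (n : ℕ∞) ≤ E.encard ∧ E.Pairwise fun x y => (segment ℝ x y ∩ B).Nonempty

section Module

variable {V W : Type*} [AddCommGroup V] [Module ℝ V] [AddCommGroup W] [Module ℝ W]
  {A B : Set V} {p q p' q' : V} {n m : ℕ}

lemma Passages.of_le (h : Passages A B p q n) (hm : m ≤ n) : Passages A B p q m := by
  obtain ⟨E, hE, hn, hsep⟩ := h
  exact ⟨E, hE, (Nat.cast_le.2 hm).trans hn, hsep⟩

lemma Passages.mono (h : Passages A B p q n) (hs : segment ℝ p q \ A ⊆ segment ℝ p' q') :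
    Passages A B p' q' n := by
  obtain ⟨E, hE, hn, hsep⟩ := h
  exact ⟨E, fun x hx => ⟨hs (hE hx), (hE hx).2⟩, hn, hsep⟩

lemma Passages.symm (h : Passages A B p q n) : Passages A B q p n :=
  h.mono (by simpa only [segment_symm ℝ q p] using sdiff_subset)

lemma not_passages_of_segment_subset (hs : segment ℝ p q ⊆ A) (hn : 0 < n) :
    ¬ Passages A B p q n := by
  rintro ⟨E, hE, hnE, -⟩
  obtain ⟨x, hx⟩ := encard_pos.1 ((Nat.cast_pos.2 hn).trans_le hnE)
  exact (hE hx).2 (hs (hE hx).1)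

lemma passages_map_iff {A B : Set W} (f : V →ᵃ[ℝ] W) (hf : Function.Injective f) :
    Passages A B (f p) (f q) n ↔ Passages (f ⁻¹' A) (f ⁻¹' B) p q n := by
  constructor
  · rintro ⟨E, hE, hn, hsep⟩
    have hrange : E ⊆ range f := fun x hx =>
      image_subset_range f _ ((image_segment ℝ f p q).superset (hE hx).1)
    refine ⟨f ⁻¹' E, fun x hx => ⟨?_, (hE hx).2⟩, ?_, fun x hx y hy hxy => ?_⟩
    · rw [← hf.mem_set_image, image_segment]
      exact (hE hx).1
    · rwa [encard_preimage_of_injective_subset_range hf hrange]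
    · simpa only [← image_segment, ← image_inter_preimage, image_nonempty]
        using hsep hx hy (hf.ne hxy)
  · rintro ⟨E, hE, hn, hsep⟩
    refine ⟨f '' E, ?_, by rwa [hf.encard_image], hf.injOn.pairwise_image.2 fun x hx y hy hxy => ?_⟩
    · rintro _ ⟨x, hx, rfl⟩
      exact ⟨image_segment ℝ f p q ▸ mem_image_of_mem f (hE hx).1, (hE hx).2⟩
    · rw [Function.onFun, ← image_segment, ← image_inter_preimage, image_nonempty]
      exact hsep hx hy hxy

lemma passages_neg : Passages (-A) (-B) p q n ↔ Passages A B (-p) (-q) n :=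
  (passages_map_iff (LinearEquiv.neg ℝ : V ≃ₗ[ℝ] V).toLinearMap.toAffineMap neg_injective).symm

end Module

section Real

variable {A B A' B' : Set ℝ} {a a' b b' : ℝ} {n : ℕ}

lemma Passages.move_left (h : Passages A B a b n) (hs : uIcc a a' ⊆ A) : Passages A B a' b n := by
  refine h.mono fun x hx => ?_
  rw [segment_eq_uIcc] at hx ⊢
  exact (uIcc_subset_uIcc_union_uIcc hx.1).resolve_left fun h => hx.2 (hs h)

lemma Passages.move_right (h : Passages A B a b n) (hs : uIcc b b' ⊆ A) : Passages A B a b' n :=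
  (h.symm.move_left hs).symm

lemma Passages.congr (h : Passages A B a b n) (hBA : B ⊆ A)
    (hA : ∀ x ∈ uIcc a b, x ∈ A' → x ∈ A) (hB : ∀ x ∈ uIoo a b, x ∈ B → x ∈ B') :
    Passages A' B' a b n := by
  obtain ⟨E, hE, hn, hsep⟩ := h
  simp only [segment_eq_uIcc] at hE hsep
  refine ⟨E, fun x hx => ?_, hn, fun x hx y hy hxy => ?_⟩ <;> simp only [segment_eq_uIcc]
  · exact ⟨(hE hx).1, fun h => (hE hx).2 (hA x (hE hx).1 h)⟩
  · obtain ⟨u, hu, huB⟩ := hsep hx hy hxy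
    refine ⟨u, hu, hB u ?_ huB⟩
    have hne {v} (hv : v ∈ E) : u ≠ v := fun h => (hE hv).2 (hBA (h ▸ huB))
    have hxab := (hE hx).1
    have hyab := (hE hy).1
    have hux := hne hx
    have huy := hne hy
    simp only [mem_uIcc] at hu hxab hyab
    simp only [uIoo, mem_Ioo, inf_lt_iff, lt_sup_iff]
    grind

end Real

/-! ### Hits from the inside and extensions on a line -/

/-- Moving upwards, one leaves `B` at the point `t` of `A`. On the trace `A` of a polygon, with `B`
the trace of its interior, one hits a perpendicular edge from the inside there. -/
def HitsUp (A B : Set ℝ) (t : ℝ) : Prop := t ∈ A \ B ∧ ∀ᶠ u in 𝓝[<] t, u ∈ B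

/-- Moving upwards from `c` until the `n`th hit, or until the last one if there are fewer, one
passes or reaches `t`. Moving downwards is moving upwards in the negated sets. -/
def ReachUp (A B : Set ℝ) (n : ℕ) (c t : ℝ) : Prop :=
  ∃ b ≥ t, HitsUp A B b ∧ {u ∈ Ioo c b | HitsUp A B u}.encard < n

/-- The extension of the interval `[lo, hi]` up to the `n`th hit on both sides. -/
def lineExtension (A B : Set ℝ) (n : ℕ) (lo hi : ℝ) : Set ℝ :=
  {t | (t < lo → ReachUp (-A) (-B) n (-lo) (-t)) ∧ (hi < t → ReachUp A B n hi t)}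

section Hits

variable {A B : Set ℝ} {a b c t x y lo hi : ℝ} {n : ℕ}

lemma mem_lineExtension_neg :
    t ∈ lineExtension (-A) (-B) n (-hi) (-lo) ↔ -t ∈ lineExtension A B n lo hi := by
  simp only [lineExtension, mem_ofPred_eq, neg_neg, neg_lt, lt_neg, and_comm]

lemma exists_hitsUp (hA : IsClosed A) (hB : IsOpen B) (hBA : B ⊆ A)
    (hx : ∀ᶠ u in 𝓝[>] x, u ∈ B) (hy : y ∉ B) (hxy : x < y) :
    ∃ h ∈ Ioc x y, HitsUp A B h ∧ Ioo x h ⊆ B := by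
  obtain ⟨w, hxw, hw⟩ := mem_nhdsGT_iff_exists_Ioo_subset.1 hx
  have hwy : w ≤ y := not_lt.1 fun h => hy (hw ⟨hxy, h⟩)
  obtain ⟨⟨hwh, hhB⟩, hleast⟩ := (isClosed_Ici.inter hB.isClosed_compl).isLeast_csInf
    (s := Ici w ∩ Bᶜ) ⟨y, hwy, hy⟩ ⟨w, fun _ hu => hu.1⟩
  set h := sInf (Ici w ∩ Bᶜ)
  have hxh : x < h := LT.lt.trans_le hxw hwh
  have hsub : Ioo x h ⊆ B := fun u hu => by
    by_contra huB
    have hwu : w ≤ u := not_lt.1 fun h => huB (hw ⟨hu.1, h⟩)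
    exact (hleast ⟨hwu, huB⟩).not_gt hu.2
  have hhA : h ∈ A := closure_minimal (hsub.trans hBA) hA <| by
    rw [closure_Ioo hxh.ne]
    exact ⟨hxh.le, le_rfl⟩
  exact ⟨h, ⟨hxh, hleast ⟨hwy, hy⟩⟩, ⟨⟨hhA, hhB⟩, mem_of_superset (Ioo_mem_nhdsLT hxh) hsub⟩, hsub⟩

lemma passages_of_le_encard_hitsUp
    (h : n ≤ {u ∈ Ico a b | HitsUp A B u ∧ ∀ᶠ v in 𝓝[>] u, v ∉ A}.encard) :
    Passages A B a b n := by
  set H := {u ∈ Ico a b | HitsUp A B u ∧ ∀ᶠ v in 𝓝[>] u, v ∉ A}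
  have exists_exit (u : ℝ) (hu : u ∈ H) : ∃ e ∈ Ioo u b, ∀ v ∈ Ioc u e, v ∉ A := by
    obtain ⟨c, huc, hc⟩ := mem_nhdsGT_iff_exists_Ioo_subset.1 hu.2.2
    obtain ⟨e, hue, he⟩ := exists_between (lt_min huc hu.1.2)
    exact ⟨e, ⟨hue, he.trans_le (min_le_right _ _)⟩,
      fun v hv => hc ⟨hv.1, hv.2.trans_lt (he.trans_le (min_le_left _ _))⟩⟩
  choose! e he heA using exists_exit
  have exit_lt {u w : ℝ} (hu : u ∈ H) (hw : w ∈ H) (huw : u < w) : e u < w := by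
    by_contra! hwe
    exact heA u hu w ⟨huw, hwe⟩ hw.2.1.1.1
  have separated {u w : ℝ} (hu : u ∈ H) (hw : w ∈ H) (huw : u < w) :
      ∃ v ∈ Ioo (e u) (e w), v ∈ B := by
    obtain ⟨v, hvB, hv⟩ := (hw.2.1.2.and (Ioo_mem_nhdsLT (exit_lt hu hw huw))).exists
    exact ⟨v, ⟨hv.1, hv.2.trans (he w hw).1⟩, hvB⟩
  have hmono : StrictMonoOn e H := fun u hu w hw huw =>
    (exit_lt hu hw huw).trans (he w hw).1
  refine ⟨e '' H, ?_, by rwa [hmono.injOn.encard_image], hmono.injOn.pairwise_image.2 ?_⟩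
  · rintro _ ⟨u, hu, rfl⟩
    refine ⟨?_, heA u hu _ ⟨(he u hu).1, le_rfl⟩⟩
    rw [segment_eq_uIcc]
    exact Icc_subset_uIcc ⟨hu.1.1.trans (he u hu).1.le, (he u hu).2.le⟩
  · intro u hu w hw huw
    simp only [Function.onFun, segment_eq_uIcc]
    rcases huw.lt_or_gt with h | h
    · obtain ⟨v, hv, hvB⟩ := separated hu hw h
      exact ⟨v, Icc_subset_uIcc (Ioo_subset_Icc_self hv), hvB⟩
    · obtain ⟨v, hv, hvB⟩ := separated hw hu h
      exact ⟨v, Icc_subset_uIcc' (Ioo_subset_Icc_self hv), hvB⟩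

lemma Passages.le_encard_hitsUp (hA : IsClosed A) (hB : IsOpen B) (hBA : B ⊆ A) (ha : a ∈ B)
    (hab : a ≤ b) (h : Passages A B a b n) : n ≤ {u ∈ Ioo a b | HitsUp A B u}.encard := by
  obtain ⟨E₀, hE₀, hn, hsep₀⟩ := h
  obtain ⟨E, hEE₀, hcard⟩ := exists_subset_encard_eq hn
  have hfin : E.Finite := finite_of_encard_eq_coe hcard
  have hsep := hsep₀.mono hEE₀
  simp only [segment_eq_uIcc, uIcc_of_le hab] at hE₀ hsep
  have hE : E ⊆ Icc a b \ A := hEE₀.trans hE₀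
  have exists_inner (x : ℝ) (hx : x ∈ E) : ∃ u ∈ Ico a x, u ∈ B ∧ ∀ y ∈ E, y < x → y < u := by
    have hax : a < x := (hE hx).1.1.lt_of_ne fun h => (hE hx).2 (hBA (h ▸ ha))
    rcases {y ∈ E | y < x}.eq_empty_or_nonempty with hempty | hne
    · exact ⟨a, ⟨le_rfl, hax⟩, ha, fun y hy hyx => (hempty.subset ⟨hy, hyx⟩).elim⟩
    · obtain ⟨y, ⟨hy, hyx⟩, hmax⟩ := exists_max_image _ id (hfin.sep _) hne
      obtain ⟨u, hu, huB⟩ := hsep hy hx hyx.ne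
      rw [uIcc_of_le hyx.le] at hu
      have hyu : y < u := hu.1.lt_of_ne fun h => (hE hy).2 (hBA (h ▸ huB))
      have hux : u < x := hu.2.lt_of_ne fun h => (hE hx).2 (hBA (h ▸ huB))
      exact ⟨u, ⟨(hE hy).1.1.trans hu.1, hux⟩, huB, fun z hz hzx => (hmax z ⟨hz, hzx⟩).trans_lt hyu⟩
  have exists_hit (x : ℝ) (hx : x ∈ E) : ∃ t ∈ Ioo a x, HitsUp A B t ∧ ∀ y ∈ E, y < x → y < t := by
    obtain ⟨u, hu, huB, hlast⟩ := exists_inner x hx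
    obtain ⟨t, ht, hhit, -⟩ := exists_hitsUp hA hB hBA (nhdsWithin_le_nhds (hB.mem_nhds huB))
      (fun h => (hE hx).2 (hBA h)) hu.2
    have htx : t < x := ht.2.lt_of_ne fun h => (hE hx).2 (h ▸ hhit.1.1)
    exact ⟨t, ⟨hu.1.trans_lt ht.1, htx⟩, hhit, fun y hy hyx => (hlast y hy hyx).trans ht.1⟩
  choose! f hf hhit hlast using exists_hit
  have hmono : StrictMonoOn f E := fun x hx y hy hxy => (hf x hx).2.trans (hlast y hy x hx hxy)
  exact hcard ▸ encard_le_encard_of_injOn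
    (fun x hx => ⟨⟨(hf x hx).1, (hf x hx).2.trans_le (hE hx).1.2⟩, hhit x hx⟩) hmono.injOn

lemma reachUp_of_encard_lt (hA : IsClosed A) (hB : IsOpen B) (hBA : B ⊆ A) (hbdd : BddAbove B)
    (ht : HitsUp A B t ∨ ∀ᶠ u in 𝓝[>] t, u ∈ B) (h : {u ∈ Ioo c t | HitsUp A B u}.encard < n) :
    ReachUp A B n c t := by
  suffices ∃ b ≥ t, HitsUp A B b ∧ ∀ u ∈ Ico t b, ¬ HitsUp A B u by
    obtain ⟨b, htb, hb, hfirst⟩ := this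
    refine ⟨b, htb, hb, h.trans_le' (encard_le_encard fun u hu => ⟨⟨hu.1.1, ?_⟩, hu.2⟩)⟩
    exact not_le.1 fun htu => hfirst u ⟨htu, hu.1.2⟩ hu.2
  by_cases hhit : HitsUp A B t
  · exact ⟨t, le_rfl, hhit, by simp⟩
  · obtain ⟨M, hM⟩ := hbdd
    obtain ⟨y, hy⟩ := exists_gt (max M t)
    have hyB : y ∉ B := fun h => (hM h).not_gt ((le_max_left _ _).trans_lt hy)
    obtain ⟨b, hb, hbhit, hsub⟩ := exists_hitsUp hA hB hBA (ht.resolve_left hhit) hyB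
      ((le_max_right _ _).trans_lt hy)
    refine ⟨b, hb.1.le, hbhit, fun u hu huhit => ?_⟩
    rcases hu.1.eq_or_lt with rfl | htu
    · exact hhit huhit
    · exact huhit.1.2 (hsub ⟨htu, hu.2⟩)

lemma ReachUp.not_passages (hA : IsClosed A) (hB : IsOpen B) (hBA : B ⊆ A) (hc : c ∈ B)
    (hct : c ≤ t) (h : ReachUp A B n c t) : ¬ Passages A B c t n := by
  obtain ⟨b, htb, -, hlt⟩ := h
  refine fun hp => hlt.not_ge ((hp.le_encard_hitsUp hA hB hBA hc hct).trans (encard_le_encard ?_))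
  exact fun u hu => ⟨⟨hu.1.1, hu.1.2.trans_le htb⟩, hu.2⟩

lemma not_passages_of_mem_lineExtension (hA : IsClosed A) (hB : IsOpen B) (hBA : B ⊆ A)
    (hn : 0 < n) (hs : Icc lo hi ⊆ B) (ha : a ∈ Icc lo hi) (ht : t ∈ lineExtension A B n lo hi) :
    ¬ Passages A B a t n := by
  intro hp
  have hmove (c : ℝ) (hc : c ∈ Icc lo hi) : Passages A B c t n :=
    hp.move_left ((uIcc_subset_Icc ha hc).trans (hs.trans hBA))
  have hle : lo ≤ hi := ha.1.trans ha.2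
  rcases lt_or_ge t lo with htlo | htlo
  · refine (ht.1 htlo).not_passages hA.neg hB.neg (neg_subset_neg.2 hBA)
      (by simpa using hs (left_mem_Icc.2 hle)) (neg_le_neg htlo.le) ?_
    rw [passages_neg, neg_neg, neg_neg]
    exact hmove lo (left_mem_Icc.2 hle)
  rcases lt_or_ge hi t with hhit | hhit
  · exact (ht.2 hhit).not_passages hA hB hBA (hs (right_mem_Icc.2 hle)) hhit.le
      (hmove hi (right_mem_Icc.2 hle))
  · refine not_passages_of_segment_subset ?_ hn hp
    rw [segment_eq_uIcc]
    exact (uIcc_subset_Icc ha ⟨htlo, hhit⟩).trans (hs.trans hBA)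

end Hits

/-! ### The two sides of a line

Let `U` and `L` be the traces of a polygon on the parallels just above and just below a line. Then
`U ∪ L` is its trace on the line itself, and `interior U ∩ interior L` is the trace of its
interior. -/

/-- The trace of the boundary on a line whose two sides are `U` and `L`. -/
def bdry (U L : Set ℝ) : Set ℝ := (U ∪ L) \ (interior U ∩ interior L)

/-- The two sides of a line coincide between `a` and `b`. -/
def Agree (U L : Set ℝ) (a b : ℝ) : Prop := ∀ x ∈ uIcc a b, x ∈ U ↔ x ∈ L

lemma interior_neg {G : Type*} [TopologicalSpace G] [InvolutiveNeg G] [ContinuousNeg G]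
    (S : Set G) : interior (-S) = -interior S :=
  ((Homeomorph.neg G).preimage_interior S).symm

lemma eventually_mem_interior {X : Type*} [TopologicalSpace X] {s S : Set X} {x : X}
    (hs : IsOpen s) (h : ∀ᶠ y in 𝓝[s] x, y ∈ S) : ∀ᶠ y in 𝓝[s] x, y ∈ interior S := by
  filter_upwards [eventually_eventually_nhdsWithin.2 h, self_mem_nhdsWithin] with y hy hys
  rw [hs.nhdsWithin_eq hys] at hy
  exact mem_interior_iff_mem_nhds.2 hy

section TwoSides

variable {U L : Set ℝ} {a b c t x z lo hi : ℝ} {n : ℕ}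

lemma inner_subset_union : interior U ∩ interior L ⊆ U ∪ L := fun _ h => .inl (interior_subset h.1)

lemma isOpen_inner : IsOpen (interior U ∩ interior L) := isOpen_interior.inter isOpen_interior

lemma inner_neg : interior (-U) ∩ interior (-L) = -(interior U ∩ interior L) := by
  rw [interior_neg, interior_neg, inter_neg]

lemma bdry_neg : bdry (-U) (-L) = -bdry U L := by
  rw [bdry, inner_neg, ← union_neg]
  rfl

lemma isCompact_bdry (hU : Tame U) (hL : Tame L) : IsCompact (bdry U L) :=
  (hU.union hL).isCompact.diff isOpen_inner

lemma mem_bdry_of_not_iff (hx : ¬ (x ∈ U ↔ x ∈ L)) : x ∈ bdry U L := by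
  have hU := @interior_subset _ _ U
  have hL := @interior_subset _ _ L
  simp only [bdry, Set.mem_sdiff, mem_union, mem_inter_iff]
  grind

lemma agree_neg : Agree (-U) (-L) a b ↔ Agree U L (-a) (-b) := by
  simp only [Agree, ← neg_uIcc]
  exact (neg_surjective (G := ℝ)).forall.trans (by simp only [Set.mem_neg, neg_neg])

lemma Agree.eventually_nhdsLT (h : Agree U L a t) (hat : a < t) :
    ∀ᶠ u in 𝓝[<] t, u ∈ U ↔ u ∈ L := by
  filter_upwards [Ioo_mem_nhdsLT hat] with u hu
    using h u (Icc_subset_uIcc (Ioo_subset_Icc_self hu))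

lemma Agree.eventually_nhdsGT (h : Agree U L t b) (htb : t < b) :
    ∀ᶠ u in 𝓝[>] t, u ∈ U ↔ u ∈ L := by
  filter_upwards [Ioo_mem_nhdsGT htb] with u hu
    using h u (Icc_subset_uIcc (Ioo_subset_Icc_self hu))

lemma Agree.mono (h : Agree U L a b) (hs : uIcc x z ⊆ uIcc a b) : Agree U L x z :=
  fun y hy => h y (hs hy)

lemma mem_interior_of_eventually (hU : IsClosed U) (hl : ∀ᶠ u in 𝓝[<] t, u ∈ U)
    (hr : ∀ᶠ u in 𝓝[>] t, u ∈ U) : t ∈ interior U := by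
  have ht : t ∈ U := hU.mem_of_frequently_of_tendsto hr.frequently
    (tendsto_id.mono_left nhdsWithin_le_nhds)
  rw [mem_interior_iff_mem_nhds, ← nhdsNE_sup_pure, ← nhdsLT_sup_nhdsGT]
  exact ⟨⟨hl, hr⟩, ht⟩

lemma eventually_notMem_of_hitsUp (hU : Tame U) (hL : Tame L)
    (hagree : ∀ᶠ u in 𝓝[>] t, u ∈ U ↔ u ∈ L)
    (h : HitsUp (U ∪ L) (interior U ∩ interior L) t) : ∀ᶠ v in 𝓝[>] t, v ∉ U ∪ L := by
  rcases hU.eventually_nhdsGT t with hr | hr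
  · refine absurd ⟨?_, ?_⟩ h.1.2
    · exact mem_interior_of_eventually hU.isCompact.isClosed
        (h.2.mono fun u hu => interior_subset hu.1) hr
    · exact mem_interior_of_eventually hL.isCompact.isClosed
        (h.2.mono fun u hu => interior_subset hu.2) (hr.congr hagree)
  · filter_upwards [hr, hagree] with v hv hiff
    simp only [mem_union, ← hiff, hv, or_self, not_false_eq_true]

lemma hitsUp_or_eventually_mem_inner (hU : Tame U) (hL : Tame L) (hat : a < t)
    (hagree : Agree U L a t) (ht : t ∈ U ∪ L) :
    HitsUp (U ∪ L) (interior U ∩ interior L) t ∨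
      ∀ᶠ u in 𝓝[>] t, u ∈ interior U ∩ interior L := by
  by_cases htB : t ∈ interior U ∩ interior L
  · exact .inr (nhdsWithin_le_nhds (isOpen_inner.mem_nhds htB))
  have hiff := hagree.eventually_nhdsLT hat
  have htUL : t ∈ U ∧ t ∈ L := by
    have := hagree t right_mem_uIcc
    rcases ht with h | h
    exacts [⟨h, this.1 h⟩, ⟨this.2 h, h⟩]
  rcases hU.eventually_nhdsLT t with hl | hl
  · exact .inl ⟨⟨ht, htB⟩, (eventually_mem_interior isOpen_Iio hl).and
      (eventually_mem_interior isOpen_Iio (hl.congr hiff))⟩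
  · have hlL : ∀ᶠ u in 𝓝[<] t, u ∉ L := by
      filter_upwards [hl, hiff] with u hu h using h.not.1 hu
    have right_of_left {S : Set ℝ} (hS : Tame S) (htS : t ∈ S) (hlS : ∀ᶠ u in 𝓝[<] t, u ∉ S) :
        ∀ᶠ u in 𝓝[>] t, u ∈ interior S :=
      eventually_mem_interior isOpen_Ioi <|
        (hS.eventually_or_eventually_of_mem htS).resolve_right fun h =>
          (h.and hlS).exists.elim fun _ hu => hu.2 hu.1
    exact .inr ((right_of_left hU htUL.1 hl).and (right_of_left hL htUL.2 hlL))

lemma Agree.passages_of_le_encard_hitsUp (hU : Tame U) (hL : Tame L) (hagree : Agree U L a b)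
    (h : n ≤ {u ∈ Ico a b | HitsUp (U ∪ L) (interior U ∩ interior L) u}.encard) :
    Passages (U ∪ L) (interior U ∩ interior L) a b n := by
  refine SlidingTransmitter.passages_of_le_encard_hitsUp
    (h.trans (encard_le_encard fun u hu => ⟨hu.1, hu.2, ?_⟩))
  have hsub : uIcc u b ⊆ uIcc a b :=
    uIcc_subset_uIcc_right (Icc_subset_uIcc (Ico_subset_Icc_self hu.1))
  exact eventually_notMem_of_hitsUp hU hL ((hagree.mono hsub).eventually_nhdsGT hu.1.2) hu.2

lemma reachUp_of_not_passages (hU : Tame U) (hL : Tame L) (hac : a ≤ c) (hct : c < t)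
    (ht : t ∈ U ∪ L) (hagree : Agree U L a t)
    (hp : ¬ Passages (U ∪ L) (interior U ∩ interior L) a t n) :
    ReachUp (U ∪ L) (interior U ∩ interior L) n c t := by
  have hUL := (hU.union hL).isCompact
  refine reachUp_of_encard_lt hUL.isClosed isOpen_inner inner_subset_union
    (hUL.bddAbove.mono inner_subset_union)
    (hitsUp_or_eventually_mem_inner hU hL (hac.trans_lt hct) hagree ht) ?_
  by_contra! hle
  refine hp (hagree.passages_of_le_encard_hitsUp hU hL (hle.trans (encard_le_encard ?_)))
  exact fun u hu => ⟨⟨hac.trans hu.1.1.le, hu.1.2⟩, hu.2⟩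

lemma mem_lineExtension_of_not_passages (hU : Tame U) (hL : Tame L) (ha : a ∈ Icc lo hi)
    (ht : t ∈ U ∪ L) (hagree : Agree U L a t)
    (hp : ¬ Passages (U ∪ L) (interior U ∩ interior L) a t n) :
    t ∈ lineExtension (U ∪ L) (interior U ∩ interior L) n lo hi := by
  refine ⟨fun htlo => ?_, fun hhit => reachUp_of_not_passages hU hL ha.2 hhit ht hagree hp⟩
  rw [← inner_neg, union_neg]
  refine reachUp_of_not_passages hU.neg hL.neg (neg_le_neg ha.1) (neg_lt_neg htlo)
    (by simpa using ht) (agree_neg.2 (by simpa using hagree)) ?_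
  rwa [inner_neg, ← union_neg, passages_neg, neg_neg, neg_neg]

lemma eventually_iff_or_eventually_not_iff (hU : Tame U) (hL : Tame L) (t : ℝ) :
    (∀ᶠ u in 𝓝[<] t, u ∈ U ↔ u ∈ L) ∨ ∀ᶠ u in 𝓝[<] t, ¬ (u ∈ U ↔ u ∈ L) := by
  rcases hU.eventually_nhdsLT t with h | h <;> rcases hL.eventually_nhdsLT t with h' | h'
  · exact .inl (by filter_upwards [h, h'] with u hu hu' using iff_of_true hu hu')
  · exact .inr (by filter_upwards [h, h'] with u hu hu' using fun hiff => hu' (hiff.1 hu))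
  · exact .inr (by filter_upwards [h, h'] with u hu hu' using fun hiff => hu (hiff.2 hu'))
  · exact .inl (by filter_upwards [h, h'] with u hu hu' using iff_of_false hu hu')

lemma exists_last_not_iff (hU : Tame U) (hL : Tame L)
    (hz : z ∈ interior U ∩ interior L) (hxz : x ≤ z) (hx : ¬ (x ∈ U ↔ x ∈ L)) :
    ∃ T, x ≤ T ∧ T < z ∧ (∀ᶠ u in 𝓝[<] T, ¬ (u ∈ U ↔ u ∈ L)) ∧
      ∀ y ∈ Ioc T z, y ∈ U ↔ y ∈ L := by
  set D := {y | y ≤ z ∧ ¬ (y ∈ U ↔ y ∈ L)}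
  have hxD : x ∈ D := ⟨hxz, hx⟩
  have hbdd : BddAbove D := ⟨z, fun y hy => hy.1⟩
  set T := sSup D
  have hTcl : T ∈ closure D := csSup_mem_closure ⟨x, hxD⟩ hbdd
  have hTz : T < z := by
    refine (csSup_le ⟨x, hxD⟩ fun y hy => hy.1).lt_of_ne fun h => ?_
    have hTb : T ∈ bdry U L :=
      closure_minimal (fun y hy => mem_bdry_of_not_iff hy.2) (isCompact_bdry hU hL).isClosed hTcl
    exact (h ▸ hTb : z ∈ bdry U L).2 hz
  have hagree : ∀ y ∈ Ioc T z, y ∈ U ↔ y ∈ L := fun y hy => by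
    by_contra h
    exact (le_csSup hbdd ⟨hy.2, h⟩).not_gt hy.1
  refine ⟨T, le_csSup hbdd hxD, hTz, ?_, hagree⟩
  refine (eventually_iff_or_eventually_not_iff hU hL T).resolve_left fun hleft => ?_
  have hne : ∀ᶠ u in 𝓝[≠] T, u ∈ U ↔ u ∈ L := by
    rw [← nhdsLT_sup_nhdsGT]
    exact eventually_sup.2 ⟨hleft, mem_of_superset (Ioc_mem_nhdsGT hTz) hagree⟩
  have hT : T ∈ U ↔ T ∈ L := by
    rw [hU.mem_iff_frequently, hL.mem_iff_frequently, frequently_congr hne]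
  have hnhds : ∀ᶠ u in 𝓝 T, u ∈ U ↔ u ∈ L := by
    rw [← nhdsNE_sup_pure]
    exact eventually_sup.2 ⟨hne, hT⟩
  obtain ⟨u, huD, hu⟩ := ((mem_closure_iff_frequently.1 hTcl).and_eventually hnhds).exists
  exact huD.2 hu

lemma exists_isMaxIcc_bdry_agree (hU : Tame U) (hL : Tame L)
    (hz : z ∈ interior U ∩ interior L) (hxz : x ≤ z) (hx : ¬ (x ∈ U ↔ x ∈ L)) :
    ∃ lo hi, lo < hi ∧ IsMaxIcc (bdry U L) lo hi ∧ x ≤ hi ∧ hi < z ∧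
      ∀ y ∈ Ioc hi z, y ∈ U ↔ y ∈ L := by
  obtain ⟨T, hxT, hTz, hleft, hagree⟩ := exists_last_not_iff hU hL hz hxz hx
  obtain ⟨w, hwT, hw⟩ := mem_nhdsLT_iff_exists_Ioo_subset.1 hleft
  have hcompact := isCompact_bdry hU hL
  have hsub : Icc w T ⊆ bdry U L := by
    rw [← closure_Ioo (ne_of_lt hwT)]
    exact closure_minimal (fun u hu => mem_bdry_of_not_iff (hw hu)) hcompact.isClosed
  obtain ⟨lo, hi, hmax, hlohi⟩ := exists_isMaxIcc hcompact (le_of_lt hwT) hsub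
  obtain ⟨hlo, hhi⟩ := (Icc_subset_Icc_iff (le_of_lt hwT)).1 hlohi
  have hhiz : hi < z := by
    by_contra! h
    exact (hmax.1 ⟨hlo.trans (le_of_lt (LT.lt.trans hwT hTz)), h⟩).2 hz
  exact ⟨lo, hi, (LT.lt.trans_le hwT hhi).trans_le' hlo, hmax, hxT.trans hhi, hhiz,
    fun y hy => hagree y ⟨hhi.trans_lt hy.1, hy.2⟩⟩

lemma exists_passages_of_not_iff_of_le (hU : Tame U) (hL : Tame L) (hn : 0 < n)
    (hz : z ∈ interior U ∩ interior L) (hxz : x ≤ z) (hx : ¬ (x ∈ U ↔ x ∈ L))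
    (hedge : ∀ lo hi, lo < hi → IsMaxIcc (bdry U L) lo hi →
      z ∉ lineExtension (U ∪ L) (interior U ∩ interior L) n lo hi) :
    ∃ t ∈ uIcc z x, Agree U L z t ∧ Passages (U ∪ L) (interior U ∩ interior L) z t n := by
  have hUL := (hU.union hL).isCompact
  obtain ⟨lo, hi, hlohi, hmax, hxhi, hhiz, hagree⟩ := exists_isMaxIcc_bdry_agree hU hL hz hxz hx
  have hhits : n ≤ {u ∈ Ioo hi z | HitsUp (U ∪ L) (interior U ∩ interior L) u}.encard := by
    by_contra! hlt
    refine hedge lo hi hlohi hmax ⟨fun h => absurd h (hlohi.trans hhiz).not_gt, fun _ => ?_⟩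
    exact reachUp_of_encard_lt hUL.isClosed isOpen_inner inner_subset_union
      (hUL.bddAbove.mono inner_subset_union)
      (.inr (nhdsWithin_le_nhds (isOpen_inner.mem_nhds hz))) hlt
  obtain ⟨H, hH, hcard⟩ := exists_subset_encard_eq hhits
  obtain ⟨t, htH, hmin⟩ := exists_min_image H id (finite_of_encard_eq_coe hcard)
    (encard_pos.1 (hcard ▸ Nat.cast_pos.2 hn))
  obtain ⟨⟨hhit, htz⟩, -⟩ := hH htH
  have hagree_t : Agree U L t z := fun y hy => by
    rw [uIcc_of_le htz.le] at hy
    exact hagree y ⟨hhit.trans_le hy.1, hy.2⟩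
  refine ⟨t, mem_uIcc.2 (.inr ⟨hxhi.trans hhit.le, htz.le⟩), ?_, ?_⟩
  · exact hagree_t.mono (uIcc_comm _ _).subset
  · refine (hagree_t.passages_of_le_encard_hitsUp hU hL ?_).symm
    exact hcard ▸ encard_le_encard fun u hu => ⟨⟨hmin u hu, (hH hu).1.2⟩, (hH hu).2⟩

lemma exists_passages_of_not_agree (hU : Tame U) (hL : Tame L) (hn : 0 < n)
    (hz : z ∈ interior U ∩ interior L)
    (hedge : ∀ lo hi, lo < hi → IsMaxIcc (bdry U L) lo hi →
      z ∉ lineExtension (U ∪ L) (interior U ∩ interior L) n lo hi) (h : ¬ Agree U L z t) :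
    ∃ t' ∈ uIcc z t, Agree U L z t' ∧ Passages (U ∪ L) (interior U ∩ interior L) z t' n := by
  simp only [Agree, not_forall, exists_prop] at h
  obtain ⟨x, hxt, hx⟩ := h
  suffices ∃ t' ∈ uIcc z x, Agree U L z t' ∧
      Passages (U ∪ L) (interior U ∩ interior L) z t' n by
    obtain ⟨t', ht', h⟩ := this
    exact ⟨t', uIcc_subset_uIcc left_mem_uIcc hxt ht', h⟩
  rcases le_total x z with hxz | hzx
  · exact exists_passages_of_not_iff_of_le hU hL hn hz hxz hx hedge
  · obtain ⟨t', ht', hagree, hp⟩ := exists_passages_of_not_iff_of_le hU.neg hL.neg hn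
      (by rw [inner_neg]; simpa using hz) (neg_le_neg hzx) (by simpa using hx)
      fun lo hi hlohi hmax => by
        rw [bdry_neg, isMaxIcc_neg] at hmax
        have := hedge (-hi) (-lo) (neg_lt_neg hlohi) hmax
        rwa [← neg_neg z, ← mem_lineExtension_neg, union_neg, ← inner_neg, neg_neg, neg_neg]
          at this
    refine ⟨-t', ?_, ?_, ?_⟩
    · rwa [← neg_uIcc, Set.mem_neg] at ht'
    · rwa [agree_neg, neg_neg] at hagree
    · rwa [inner_neg, ← union_neg, passages_neg, neg_neg] at hp

end TwoSides

/-! ### Crossings -/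

section Crossings

variable {P : Set (ℝ × ℝ)} {p q : ℝ × ℝ} {k r : ℕ}

lemma HasExteriorPassages.passages (h : HasExteriorPassages P p q r) :
    Passages P (interior P) p q r := by
  obtain ⟨t, ht, hsep⟩ := h
  set x : Fin r → ℝ × ℝ := fun i => AffineMap.lineMap p q (t i)
  have separated {i j : Fin r} (hij : i < j) : (segment ℝ (x i) (x j) ∩ interior P).Nonempty := by
    obtain ⟨u, hiu, huj, hu⟩ := hsep i j hij
    refine ⟨_, ?_, hu⟩
    rw [← image_segment, segment_eq_uIcc]
    exact mem_image_of_mem _ (Icc_subset_uIcc ⟨hiu.le, huj.le⟩)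
  have ne_of_lt {i j : Fin r} (hij : i < j) : x i ≠ x j := fun h => by
    obtain ⟨y, hy, hyP⟩ := separated hij
    rw [← h, segment_same, mem_singleton_iff] at hy
    exact (ht i).2 (interior_subset (hy ▸ hyP : x i ∈ interior P))
  have hinj : Function.Injective x := fun i j h =>
    le_antisymm (not_lt.1 fun hji => ne_of_lt hji h.symm) (not_lt.1 fun hij => ne_of_lt hij h)
  refine ⟨range x, ?_, ?_, ?_⟩
  · rintro _ ⟨i, rfl⟩
    refine ⟨?_, (ht i).2⟩
    rw [segment_eq_image_lineMap]
    exact mem_image_of_mem _ (ht i).1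
  · simpa using hinj.encard_range
  · rintro _ ⟨i, rfl⟩ _ ⟨j, rfl⟩ hij
    rcases lt_or_gt_of_ne (ne_of_apply_ne x hij) with h | h
    · exact separated h
    · simpa only [segment_symm ℝ (x i)] using separated h

lemma Passages.hasExteriorPassages (h : Passages P (interior P) p q r) :
    HasExteriorPassages P p q r := by
  obtain ⟨E₀, hE₀, hr, hsep⟩ := h
  obtain ⟨E, hE, hcard⟩ := exists_subset_encard_eq hr
  have exists_param (x : ℝ × ℝ) (hx : x ∈ E) : ∃ τ ∈ Icc (0 : ℝ) 1, AffineMap.lineMap p q τ = x :=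
    (segment_eq_image_lineMap ℝ p q).subset (hE₀ (hE hx)).1
  choose! τ hτ hline using exists_param
  have hinj : InjOn τ E := fun x hx y hy h => by rw [← hline x hx, ← hline y hy, h]
  have hcard' : (τ '' E).encard = r := hinj.encard_image.trans hcard
  have hfin : (τ '' E).Finite := finite_of_encard_eq_coe hcard'
  have hcardF : hfin.toFinset.card = r := by
    rw [hfin.encard_eq_coe_toFinset_card] at hcard'
    exact_mod_cast hcard'
  set t := hfin.toFinset.orderEmbOfFin hcardF
  have exists_eq (i : Fin r) : ∃ x ∈ E, τ x = t i :=
    hfin.mem_toFinset.1 (hfin.toFinset.orderEmbOfFin_mem hcardF i)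
  choose x hx hxt using exists_eq
  have hline_t (i : Fin r) : AffineMap.lineMap p q (t i) = x i := by rw [← hxt, hline _ (hx i)]
  have hnotMem (i : Fin r) : AffineMap.lineMap p q (t i) ∉ P :=
    hline_t i ▸ (hE₀ (hE (hx i))).2
  refine ⟨t, fun i => ⟨hxt i ▸ hτ _ (hx i), hnotMem i⟩, fun i j hij => ?_⟩
  have hlt : t i < t j := t.lt_iff_lt.2 hij
  have hne : x i ≠ x j := fun h => hlt.ne (by rw [← hxt i, ← hxt j, h])
  obtain ⟨y, hy, hyP⟩ := hsep (hE (hx i)) (hE (hx j)) hne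
  rw [← hline_t, ← hline_t, ← image_segment, segment_eq_uIcc, uIcc_of_le hlt.le] at hy
  obtain ⟨u, hu, rfl⟩ := hy
  exact ⟨u, hu.1.lt_of_ne fun h => hnotMem i (h ▸ interior_subset hyP),
    hu.2.lt_of_ne fun h => hnotMem j (h ▸ interior_subset hyP), hyP⟩

lemma hasExteriorPassages_iff :
    HasExteriorPassages P p q r ↔ Passages P (interior P) p q r :=
  ⟨HasExteriorPassages.passages, Passages.hasExteriorPassages⟩

lemma crossings_le_iff : crossings P p q ≤ k ↔ ¬ Passages P (interior P) p q (k / 2 + 1) := by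
  simp only [crossings, iSup_le_iff, hasExteriorPassages_iff, Nat.cast_le]
  refine ⟨fun h hp => ?_, fun h r hr => ?_⟩
  · have := h _ hp
    omega
  · by_contra! hlt
    exact h (hr.of_le (by omega))

lemma isOpen_setOf_hasExteriorPassages (hP : IsClosed P) (r : ℕ) :
    IsOpen {pq : (ℝ × ℝ) × (ℝ × ℝ) | HasExteriorPassages P pq.1 pq.2 r} := by
  rw [isOpen_iff_mem_nhds]
  rintro ⟨p, q⟩ ⟨t, ht, hsep⟩
  choose! u hiu huj hu using hsep
  have hcont (τ : ℝ) : Continuous fun pq : (ℝ × ℝ) × (ℝ × ℝ) => AffineMap.lineMap pq.1 pq.2 τ :=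
    continuous_fst.lineMap continuous_snd continuous_const
  have houtside : ∀ᶠ pq in 𝓝 (p, q), ∀ i, AffineMap.lineMap pq.1 pq.2 (t i) ∉ P :=
    eventually_all.2 fun i =>
      (hcont _).continuousAt.eventually (hP.isOpen_compl.mem_nhds (ht i).2)
  have hinside : ∀ᶠ pq in 𝓝 (p, q), ∀ i j, i < j →
      AffineMap.lineMap pq.1 pq.2 (u i j) ∈ interior P :=
    eventually_all.2 fun i => eventually_all.2 fun j => eventually_imp_distrib_left.2 fun hij =>
      (hcont _).continuousAt.eventually (isOpen_interior.mem_nhds (hu i j hij))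
  filter_upwards [houtside, hinside] with pq hout hin
    using ⟨t, fun i => ⟨(ht i).1, hout i⟩,
      fun i j hij => ⟨u i j, hiu i j hij, huj i j hij, hin i j hij⟩⟩

lemma isClosed_setOf_crossings_le (hP : IsClosed P) (k : ℕ) :
    IsClosed {pq : (ℝ × ℝ) × (ℝ × ℝ) | crossings P pq.1 pq.2 ≤ k} := by
  simp only [crossings_le_iff, ← hasExteriorPassages_iff]
  exact (isOpen_setOf_hasExteriorPassages hP _).isClosed_compl

end Crossings

/-! ### Lines in the plane -/

section Coordinates

variable {d : Dir} {c t c' t' : ℝ}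

@[simp] lemma Dir.perp_perp (d : Dir) : d.perp.perp = d := by cases d <;> rfl

@[simp] lemma coord_pt (d : Dir) (c t : ℝ) : coord d (pt d c t) = t := by cases d <;> rfl

@[simp] lemma coord_perp_pt (d : Dir) (c t : ℝ) : coord d.perp (pt d c t) = c := by
  cases d <;> rfl

@[simp] lemma pt_coord (d : Dir) (p : ℝ × ℝ) : pt d (coord d.perp p) (coord d p) = p := by
  cases d <;> rfl

lemma pt_perp (d : Dir) (c t : ℝ) : pt d.perp c t = pt d t c := by cases d <;> rfl

lemma pt_inj : pt d c t = pt d c' t' ↔ c = c' ∧ t = t' := by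
  cases d <;> simp [pt, and_comm]

lemma continuous_coord (d : Dir) : Continuous (coord d) := by
  cases d
  exacts [continuous_fst, continuous_snd]

lemma continuous_pt (d : Dir) : Continuous fun q : ℝ × ℝ => pt d q.1 q.2 := by
  cases d
  exacts [continuous_snd.prodMk continuous_fst, continuous_id]

/-- The coordinates with respect to the lines of direction `d`, level first. -/
def ptHomeomorph (d : Dir) : ℝ × ℝ ≃ₜ ℝ × ℝ where
  toFun q := pt d q.1 q.2
  invFun p := (coord d.perp p, coord d p)
  left_inv q := by simp
  right_inv p := pt_coord d p
  continuous_toFun := continuous_pt d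
  continuous_invFun := (continuous_coord d.perp).prodMk (continuous_coord d)

end Coordinates

/-- The trace of `K` on the line of direction `d` at level `c`. -/
def line (K : Set (ℝ × ℝ)) (d : Dir) (c : ℝ) : Set ℝ := pt d c ⁻¹' K

section Line

variable {K P : Set (ℝ × ℝ)} {d : Dir} {c t : ℝ}

@[simp] lemma mem_line : t ∈ line K d c ↔ pt d c t ∈ K := Iff.rfl

lemma isClosed_line (hK : IsClosed K) (d : Dir) (c : ℝ) : IsClosed (line K d c) :=
  hK.preimage ((continuous_pt d).comp (Continuous.prodMk_right c))

lemma isOpen_line (hK : IsOpen K) (d : Dir) (c : ℝ) : IsOpen (line K d c) :=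
  hK.preimage ((continuous_pt d).comp (Continuous.prodMk_right c))

lemma isCompact_line (hK : IsCompact K) (d : Dir) (c : ℝ) : IsCompact (line K d c) :=
  (hK.image (continuous_coord d)).of_isClosed_subset (isClosed_line hK.isClosed d c)
    fun t ht => ⟨pt d c t, ht, coord_pt d c t⟩

lemma line_interior_subset : line (interior P) d c ⊆ line P d c := preimage_mono interior_subset

lemma mem_line_interior :
    t ∈ line (interior P) d c ↔ ∀ᶠ q in 𝓝 c ×ˢ 𝓝 t, q.2 ∈ line P d q.1 := by
  rw [mem_line, mem_interior_iff_mem_nhds, ← nhds_prod_eq]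
  exact ((ptHomeomorph d).map_nhds_eq (c, t)).symm ▸ Iff.rfl

lemma passages_line_iff {A B : Set (ℝ × ℝ)} {a b : ℝ} {n : ℕ} :
    Passages A B (pt d c a) (pt d c b) n ↔ Passages (line A d c) (line B d c) a b n := by
  have hf : ⇑(AffineMap.lineMap (pt d c 0) (pt d c 1) : ℝ →ᵃ[ℝ] ℝ × ℝ) = pt d c := by
    ext t : 1
    cases d <;> simp [pt, AffineMap.lineMap_apply]
  have hinj : Function.Injective (pt d c) := fun a b h => (pt_inj.1 h).2
  simpa only [hf] using! passages_map_iff (A := A) (B := B) (p := a) (q := b) (n := n)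
    (AffineMap.lineMap (pt d c 0) (pt d c 1)) (by rwa [hf])

end Line

section Carrier

variable {K P : Set (ℝ × ℝ)} {s e : Seg} {c t : ℝ}

lemma pt_mem_carrier : pt s.dir c t ∈ s.carrier ↔ c = s.level ∧ t ∈ Icc s.lo s.hi := by
  constructor
  · rintro ⟨u, hu, h⟩
    obtain ⟨rfl, rfl⟩ := pt_inj.1 h
    exact ⟨rfl, hu⟩
  · rintro ⟨rfl, ht⟩
    exact ⟨t, ht, rfl⟩

lemma carrier_subset_iff : s.carrier ⊆ K ↔ Icc s.lo s.hi ⊆ line K s.dir s.level :=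
  image_subset_iff

lemma eq_of_carrier_subset (h : e.carrier ⊆ s.carrier) :
    s.dir = e.dir ∧ s.level = e.level ∧ s.lo ≤ e.lo ∧ e.hi ≤ s.hi := by
  have hlo := h (mem_image_of_mem _ (left_mem_Icc.2 e.lo_lt_hi.le))
  have hhi := h (mem_image_of_mem _ (right_mem_Icc.2 e.lo_lt_hi.le))
  have hdir : s.dir = e.dir := by
    by_contra hne
    have hperp : e.dir = s.dir.perp := by
      revert hne
      cases s.dir <;> cases e.dir <;> simp [Dir.perp]
    rw [hperp, pt_perp, pt_mem_carrier] at hlo hhi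
    exact e.lo_lt_hi.ne (hlo.1.trans hhi.1.symm)
  rw [← hdir, pt_mem_carrier] at hlo hhi
  exact ⟨hdir, hlo.1.symm, hlo.2.1, hhi.2.2⟩

lemma maximal_carrier_iff :
    (s.carrier ⊆ K ∧ ∀ s' : Seg, s'.carrier ⊆ K → s.carrier ⊆ s'.carrier → s' = s) ↔
      IsMaxIcc (line K s.dir s.level) s.lo s.hi := by
  refine and_congr carrier_subset_iff ⟨fun h a b ha hb hs => ?_, fun h s' hs' hss' => ?_⟩
  · have hab : a < b := ha.trans_lt (s.lo_lt_hi.trans_le hb)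
    have heq := h ⟨s.dir, s.level, a, b, hab⟩ (carrier_subset_iff.2 hs)
      (image_mono (Icc_subset_Icc ha hb))
    exact (Seg.ext_iff.1 heq).2.2
  · obtain ⟨hdir, hlevel, hlo, hhi⟩ := eq_of_carrier_subset hss'
    rw [carrier_subset_iff, hdir, hlevel] at hs'
    obtain ⟨hlo', hhi'⟩ := h _ _ hlo hhi hs'
    exact Seg.ext hdir hlevel hlo' hhi'

lemma isEdge_iff : IsEdge P e ↔ IsMaxIcc (line (frontier P) e.dir e.level) e.lo e.hi :=
  maximal_carrier_iff

end Carrier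

/-- The set `P` is a finite union of non-degenerate closed axis-parallel rectangles. -/
def IsRectangleUnion (P : Set (ℝ × ℝ)) : Prop :=
  ∃ F : Finset ((ℝ × ℝ) × (ℝ × ℝ)),
    (∀ r ∈ F, r.1.1 < r.2.1 ∧ r.1.2 < r.2.2) ∧ P = ⋃ r ∈ F, Icc r.1 r.2

/-- Just above and just below the line of direction `d` at level `c`, the traces of `P` on the
parallels are the tame sets `U` and `L`, and its trace on the line itself is `U ∪ L`. -/
structure Sides (P : Set (ℝ × ℝ)) (d : Dir) (c : ℝ) (U L : Set ℝ) : Prop where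
  tame_above : Tame U
  tame_below : Tame L
  isStepAt : IsStepAt (line P d) c U L

lemma eventually_prod_nhds_iff {α X : Type*} [TopologicalSpace X] {l : Filter α} [l.NeBot]
    {f : α → Set X} {S : Set X} {t : X} (h : ∀ᶠ x in l, f x = S) :
    (∀ᶠ q in l ×ˢ 𝓝 t, q.2 ∈ f q.1) ↔ t ∈ interior S := by
  have hS : ∀ᶠ q in l ×ˢ 𝓝 t, q.2 ∈ f q.1 ↔ q.2 ∈ S :=
    (h.prod_inl (𝓝 t)).mono fun q hq => by rw [hq]
  have hsnd : (∀ᶠ q in l ×ˢ 𝓝 t, q.2 ∈ S) ↔ ∀ᶠ y in map Prod.snd (l ×ˢ 𝓝 t), y ∈ S :=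
    eventually_map.symm
  rw [eventually_congr hS, hsnd, map_snd_prod, mem_interior_iff_mem_nhds, Filter.Eventually,
    ofPred_mem_eq]

namespace Sides

variable {P Q : Set (ℝ × ℝ)} {d : Dir} {c : ℝ} {U L U' L' : Set ℝ}

lemma union (h : Sides P d c U L) (h' : Sides Q d c U' L') :
    Sides (P ∪ Q) d c (U ∪ U') (L ∪ L') :=
  ⟨h.tame_above.union h'.tame_above, h.tame_below.union h'.tame_below, h.isStepAt.sup h'.isStepAt⟩

lemma line_eq (h : Sides P d c U L) : line P d c = U ∪ L := h.isStepAt.value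

lemma line_interior (h : Sides P d c U L) :
    line (interior P) d c = interior U ∩ interior L := by
  ext t
  rw [mem_line_interior, ← nhdsNE_sup_pure, ← nhdsLT_sup_nhdsGT, Filter.sup_prod, Filter.sup_prod,
    eventually_sup, eventually_sup, eventually_prod_nhds_iff h.isStepAt.below,
    eventually_prod_nhds_iff h.isStepAt.above,
    eventually_prod_nhds_iff (eventually_pure.2 h.line_eq)]
  exact ⟨fun ht => ⟨ht.1.2, ht.1.1⟩,
    fun ht => ⟨⟨ht.2, ht.1⟩, interior_mono subset_union_left ht.1⟩⟩

lemma line_frontier (h : Sides P d c U L) (hP : IsClosed P) :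
    line (frontier P) d c = bdry U L := by
  rw [bdry, ← h.line_eq, ← h.line_interior, hP.frontier_eq]
  rfl

lemma eventually_above (h : Sides P d c U L) : ∀ᶠ c' in 𝓝[>] c, Sides P d c' U U := by
  filter_upwards [eventually_eventually_nhdsWithin.2 h.isStepAt.above, h.isStepAt.above,
    self_mem_nhdsWithin] with c' hnear heq hc'
  rw [isOpen_Ioi.nhdsWithin_eq hc'] at hnear
  exact ⟨h.tame_above, h.tame_above, hnear.filter_mono nhdsWithin_le_nhds,
    hnear.filter_mono nhdsWithin_le_nhds, heq.trans (union_self U).symm⟩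

lemma eventually_below (h : Sides P d c U L) : ∀ᶠ c' in 𝓝[<] c, Sides P d c' L L := by
  filter_upwards [eventually_eventually_nhdsWithin.2 h.isStepAt.below, h.isStepAt.below,
    self_mem_nhdsWithin] with c' hnear heq hc'
  rw [isOpen_Iio.nhdsWithin_eq hc'] at hnear
  exact ⟨h.tame_below, h.tame_below, hnear.filter_mono nhdsWithin_le_nhds,
    hnear.filter_mono nhdsWithin_le_nhds, heq.trans (union_self L).symm⟩

end Sides

lemma exists_sides_Icc {a b : ℝ × ℝ} (hab : a.1 < b.1 ∧ a.2 < b.2) (d : Dir) (c : ℝ) :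
    ∃ U L, Sides (Icc a b) d c U L := by
  have hlt : ∀ d' : Dir, coord d' a < coord d' b := by
    rintro (_ | _)
    exacts [hab.1, hab.2]
  let φ : SupHom Prop (Set ℝ) :=
    { toFun q := {t | q ∧ t ∈ Icc (coord d a) (coord d b)}
      map_sup' q q' := by ext t; exact or_and_right }
  have htame : ∀ q, Tame (φ q) := fun q => by
    by_cases hq : q
    · simpa [φ, hq] using! Tame.Icc (hlt d)
    · simpa [φ, hq] using! Tame.empty
  have hline : line (Icc a b) d = φ ∘ (· ∈ Icc (coord d.perp a) (coord d.perp b)) := by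
    ext c t
    cases d <;> simp [φ, pt, coord, Dir.perp, Prod.le_def] <;> tauto
  exact ⟨_, _, htame _, htame _, hline ▸ (IsStepAt.mem_Icc (hlt d.perp) c).map φ⟩

namespace IsRectangleUnion

variable {P : Set (ℝ × ℝ)}

lemma isCompact (hP : IsRectangleUnion P) : IsCompact P := by
  obtain ⟨F, -, rfl⟩ := hP
  exact F.isCompact_biUnion fun r _ => isCompact_Icc

lemma exists_sides (hP : IsRectangleUnion P) (d : Dir) (c : ℝ) : ∃ U L, Sides P d c U L := by
  classical
  obtain ⟨F, hF, rfl⟩ := hP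
  induction F using Finset.induction_on with
  | empty => exact ⟨∅, ∅, .empty, .empty, by simpa using! IsStepAt.const (∅ : Set ℝ) c⟩
  | insert r F _ ih =>
    obtain ⟨hr, hF⟩ := (Finset.forall_mem_insert _ _ _).1 hF
    obtain ⟨U, L, h⟩ := exists_sides_Icc hr d c
    obtain ⟨U', L', h'⟩ := ih hF
    rw [Finset.set_biUnion_insert]
    exact ⟨_, _, h.union h'⟩

end IsRectangleUnion

/-! ### Extensions and visibility -/

section Extension

variable {P : Set (ℝ × ℝ)} {k : ℕ} {d : Dir} {c t lo hi : ℝ} {s : Seg} {p : ℝ × ℝ}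

lemma hitFwd_iff (hP : IsClosed P) :
    HitFwd P d c t ↔ HitsUp (line P d c) (line (interior P) d c) t := by
  rw [HitFwd, hP.frontier_eq]
  exact and_congr Iff.rfl mem_nhdsLT_iff_exists_Ioo_subset.symm

lemma hitBwd_iff (hP : IsClosed P) :
    HitBwd P d c t ↔ HitsUp (-line P d c) (-line (interior P) d c) (-t) := by
  have hmap : map Neg.neg (𝓝[>] t) = 𝓝[<] (-t) := by
    simp
  rw [HitBwd, hP.frontier_eq, HitsUp, ← hmap, eventually_map]
  simp only [Set.mem_sdiff, Set.mem_neg, neg_neg]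
  exact and_congr Iff.rfl mem_nhdsGT_iff_exists_Ioo_subset.symm

lemma reachUp_line_iff (hP : IsClosed P) (ht : hi < t) :
    ReachUp (line P d c) (line (interior P) d c) (k / 2 + 1) hi t ↔
      ∃ b ≥ t, ReachFwd P k d c hi b := by
  refine exists_congr fun b => and_congr_right fun hb => ?_
  rw [ReachFwd, hitFwd_iff hP, and_iff_right (ht.trans_le hb)]
  simp only [hitFwd_iff hP, ← and_assoc]
  rfl

lemma reachUp_neg_line_iff (hP : IsClosed P) (ht : t < lo) :
    ReachUp (-line P d c) (-line (interior P) d c) (k / 2 + 1) (-lo) (-t) ↔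
      ∃ a ≤ t, ReachBwd P k d c lo a := by
  refine (neg_surjective.exists).trans (exists_congr fun a => ?_)
  rw [ge_iff_le, neg_le_neg_iff]
  refine and_congr_right fun ha => ?_
  have hset : {u ∈ Ioo (-lo) (-a) | HitsUp (-line P d c) (-line (interior P) d c) u} =
      -{u | a < u ∧ u < lo ∧ HitBwd P d c u} := by
    ext u
    simp only [Set.mem_neg, hitBwd_iff hP, mem_ofPred_eq, mem_Ioo, neg_neg, neg_lt, lt_neg,
      ← and_assoc, and_comm (a := u < _)]
  rw [ReachBwd, ← hitBwd_iff hP, hset, encard_neg, and_iff_right (ha.trans_lt ht)]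

lemma mem_extension_iff (hP : IsClosed P) :
    pt s.dir s.level t ∈ extension P k s ↔
      t ∈ lineExtension (line P s.dir s.level) (line (interior P) s.dir s.level) (k / 2 + 1)
        s.lo s.hi := by
  constructor
  · rintro ⟨a, b, ha, hb, u, ⟨hau, hub⟩, hut⟩
    obtain rfl : u = t := (pt_inj.1 hut).2
    refine ⟨fun hlt => (reachUp_neg_line_iff hP hlt).2 ⟨a, hau, ha.resolve_left ?_⟩,
      fun hlt => (reachUp_line_iff hP hlt).2 ⟨b, hub, hb.resolve_left ?_⟩⟩
    exacts [(hau.trans_lt hlt).ne, (hlt.trans_le hub).ne']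
  · rintro ⟨hlow, hupp⟩
    have hleft : ∃ a ≤ t, a = s.lo ∨ ReachBwd P k s.dir s.level s.lo a := by
      rcases lt_or_ge t s.lo with hlt | hge
      · obtain ⟨a, hat, ha⟩ := (reachUp_neg_line_iff hP hlt).1 (hlow hlt)
        exact ⟨a, hat, .inr ha⟩
      · exact ⟨s.lo, hge, .inl rfl⟩
    have hright : ∃ b ≥ t, b = s.hi ∨ ReachFwd P k s.dir s.level s.hi b := by
      rcases lt_or_ge s.hi t with hlt | hge
      · obtain ⟨b, hbt, hb⟩ := (reachUp_line_iff hP hlt).1 (hupp hlt)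
        exact ⟨b, hbt, .inr hb⟩
      · exact ⟨s.hi, hge, .inl rfl⟩
    obtain ⟨a, hat, ha⟩ := hleft
    obtain ⟨b, hbt, hb⟩ := hright
    exact ⟨a, b, ha, hb, t, ⟨hat, hbt⟩, rfl⟩

lemma level_eq_of_mem_extension (h : p ∈ extension P k s) : coord s.dir.perp p = s.level := by
  obtain ⟨_, _, -, -, t, -, rfl⟩ := h
  exact coord_perp_pt _ _ _

lemma notMem_lineExtension_of_mem_cutInterior (hP : IsClosed P)
    (ht : pt d c t ∈ cutInterior P k d) (hlt : lo < hi)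
    (hmax : IsMaxIcc (line (frontier P) d c) lo hi) :
    t ∉ lineExtension (line P d c) (line (interior P) d c) (k / 2 + 1) lo hi := fun hmem =>
  ht.2 <| mem_iUnion₂.2
    ⟨⟨d, c, lo, hi, hlt⟩, ⟨isEdge_iff.2 hmax, rfl⟩, (mem_extension_iff hP).2 hmem⟩

lemma Sides.exists_passages_of_not_agree {U L : Set ℝ} {a : ℝ} (hs : Sides P d c U L)
    (hP : IsClosed P) (ha : pt d c a ∈ cutInterior P k d) (h : ¬ Agree U L a t) :
    ∃ t' ∈ uIcc a t, Agree U L a t' ∧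
      Passages (line P d c) (line (interior P) d c) a t' (k / 2 + 1) := by
  have hz : a ∈ line (interior P) d c := ha.1
  have hedge := fun lo hi => notMem_lineExtension_of_mem_cutInterior (lo := lo) (hi := hi) hP ha
  rw [hs.line_frontier hP] at hedge
  rw [hs.line_eq, hs.line_interior] at hedge ⊢
  rw [hs.line_interior] at hz
  exact SlidingTransmitter.exists_passages_of_not_agree hs.tame_above hs.tame_below
    (Nat.succ_pos _) hz hedge h

end Extension

/-- The point with coordinate `t` on the line of direction `d` through `p` belongs to `P`, and the
segment from `p` to it crosses the boundary at most `k` times. -/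
def Visible (P : Set (ℝ × ℝ)) (k : ℕ) (d : Dir) (p : ℝ × ℝ) (t : ℝ) : Prop :=
  pt d (coord d.perp p) t ∈ P ∧ crossings P p (pt d (coord d.perp p) t) ≤ k

section Visible

variable {P : Set (ℝ × ℝ)} {k : ℕ} {d : Dir} {c t : ℝ} {s r : Seg} {z p : ℝ × ℝ}

lemma visible_iff : Visible P k d z t ↔ t ∈ line P d (coord d.perp z) ∧
    ¬ Passages (line P d (coord d.perp z)) (line (interior P) d (coord d.perp z)) (coord d z) t
      (k / 2 + 1) := by
  rw [Visible, crossings_le_iff, ← passages_line_iff, pt_coord]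
  rfl

lemma sees_iff (hs : IsTransmitter P s) : Sees P k s p ↔
    coord s.dir p ∈ Icc s.lo s.hi ∧ Visible P k s.dir.perp p s.level := by
  refine and_congr_right fun h => ?_
  rw [Visible, Dir.perp_perp, pt_perp]
  exact (and_iff_right (carrier_subset_iff.1 hs h)).symm

lemma isClosed_setOf_sees (hP : IsClosed P) (k : ℕ) (s : Seg) : IsClosed {p | Sees P k s p} := by
  have hfoot : Continuous fun p => pt s.dir s.level (coord s.dir p) :=
    (continuous_pt s.dir).comp (continuous_const.prodMk (continuous_coord s.dir))
  exact (isClosed_Icc.preimage (continuous_coord s.dir)).inter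
    ((isClosed_setOf_crossings_le hP k).preimage (continuous_id.prodMk hfoot))

lemma Agree.mem_interior_iff {U L : Set ℝ} {a b x : ℝ} (h : Agree U L a b) (hx : x ∈ uIoo a b) :
    x ∈ interior U ↔ x ∈ interior L := by
  rw [mem_interior_iff_mem_nhds, mem_interior_iff_mem_nhds]
  refine eventually_congr ?_
  filter_upwards [isOpen_Ioo.mem_nhds hx] with y hy using h y (Ioo_subset_Icc_self hy)

lemma Sides.eventually_line_iff {U L : Set ℝ} (hs : Sides P d c U L) :
    ∀ᶠ c' in 𝓝 c, ∀ a b, Agree U L a b →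
      (∀ x ∈ uIcc a b, x ∈ line P d c' ↔ x ∈ line P d c) ∧
      ∀ x ∈ uIoo a b, x ∈ line (interior P) d c' ↔ x ∈ line (interior P) d c := by
  rw [← nhdsNE_sup_pure, ← nhdsLT_sup_nhdsGT, eventually_sup, eventually_sup]
  refine ⟨⟨?_, ?_⟩, eventually_pure.2 fun _ _ _ => ⟨fun _ _ => Iff.rfl, fun _ _ => Iff.rfl⟩⟩
  · filter_upwards [hs.eventually_below] with c' hs' a b h
    rw [hs'.line_eq, hs'.line_interior, hs.line_eq, hs.line_interior, union_self, inter_self]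
    exact ⟨fun x hx => by rw [mem_union, h x hx, or_self],
      fun x hx => by rw [mem_inter_iff, h.mem_interior_iff hx, and_self]⟩
  · filter_upwards [hs.eventually_above] with c' hs' a b h
    rw [hs'.line_eq, hs'.line_interior, hs.line_eq, hs.line_interior, union_self, inter_self]
    exact ⟨fun x hx => by rw [mem_union, h x hx, or_self],
      fun x hx => by rw [mem_inter_iff, h.mem_interior_iff hx, and_self]⟩

lemma eventually_uIcc_subset_line (hz : z ∈ interior P) (d : Dir) :
    ∀ᶠ w in 𝓝 z, uIcc (coord d w) (coord d z) ⊆ line P d (coord d.perp w) := by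
  rw [← pt_coord d z, ← mem_line, mem_line_interior] at hz
  obtain ⟨C, hC, T, hT, hsub⟩ := mem_prod_iff.1 hz
  have huIcc : ∀ᶠ w in 𝓝 z, uIcc (coord d w) (coord d z) ⊆ T :=
    ((continuous_coord d).tendsto z |>.uIcc tendsto_const_nhds).eventually
      (eventually_smallSets_subset.2 hT)
  filter_upwards [huIcc, (continuous_coord d.perp).tendsto z hC] with w hw hwC x hx
    using hsub (mk_mem_prod hwC (hw hx))

lemma visible_self (hz : z ∈ P) : Visible P k d z (coord d z) := by
  rw [visible_iff, mem_line, pt_coord]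
  refine ⟨hz, not_passages_of_segment_subset ?_ (Nat.succ_pos _)⟩
  rwa [segment_same, singleton_subset_iff, mem_line, pt_coord]

lemma Visible.move {t' : ℝ} (h : Visible P k d z t)
    (hs : uIcc t t' ⊆ line P d (coord d.perp z)) : Visible P k d z t' := by
  rw [visible_iff] at h ⊢
  exact ⟨hs right_mem_uIcc, fun hp => h.2 (hp.move_right (by rwa [uIcc_comm]))⟩

lemma eventually_visible_iff (hP : IsRectangleUnion P) (hz : z ∈ cutInterior P k d) :
    ∀ᶠ w in 𝓝 z, ∀ t, Visible P k d w t ↔ Visible P k d z t := by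
  obtain ⟨U, L, hs⟩ := hP.exists_sides d (coord d.perp z)
  filter_upwards [(continuous_coord d.perp).continuousAt.eventually hs.eventually_line_iff,
    eventually_uIcc_subset_line hz.1 d] with w hw hseg t
  have hmove : Passages (line P d (coord d.perp w)) (line (interior P) d (coord d.perp w))
      (coord d w) t (k / 2 + 1) ↔ Passages (line P d (coord d.perp w))
      (line (interior P) d (coord d.perp w)) (coord d z) t (k / 2 + 1) :=
    ⟨fun h => h.move_left hseg, fun h => h.move_left (by rwa [uIcc_comm])⟩
  have hcongr : ∀ t', Agree U L (coord d z) t' →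
      (Passages (line P d (coord d.perp w)) (line (interior P) d (coord d.perp w))
        (coord d z) t' (k / 2 + 1) ↔
      Passages (line P d (coord d.perp z)) (line (interior P) d (coord d.perp z))
        (coord d z) t' (k / 2 + 1)) := fun t' hagree => by
    obtain ⟨houter, hinner⟩ := hw _ _ hagree
    exact ⟨fun h => h.congr line_interior_subset (fun x hx => (houter x hx).2)
        fun x hx => (hinner x hx).1,
      fun h => h.congr line_interior_subset (fun x hx => (houter x hx).1)
        fun x hx => (hinner x hx).2⟩
  rw [visible_iff, visible_iff, hmove]
  by_cases hagree : Agree U L (coord d z) t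
  · exact and_congr ((hw _ _ hagree).1 t right_mem_uIcc) (not_congr (hcongr t hagree))
  · obtain ⟨t', ht', hagree', hp⟩ := hs.exists_passages_of_not_agree hP.isCompact.isClosed
      (by rwa [pt_coord]) hagree
    have hsub : segment ℝ (coord d z) t' ⊆ segment ℝ (coord d z) t := by
      rw [segment_eq_uIcc, segment_eq_uIcc]
      exact uIcc_subset_uIcc_left ht'
    exact iff_of_false (fun h => h.2 (((hcongr t' hagree').2 hp).mono (sdiff_subset.trans hsub)))
      fun h => h.2 (hp.mono (sdiff_subset.trans hsub))

lemma visible_iff_mem_extension (hP : IsRectangleUnion P) (hr : r.carrier ⊆ cutInterior P k r.dir)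
    (hz : z ∈ r.carrier) : Visible P k r.dir z t ↔
      pt r.dir r.level t ∈ P ∧ pt r.dir r.level t ∈ extension P k r := by
  obtain ⟨a, ha, rfl⟩ := hz
  have hcl := hP.isCompact.isClosed
  obtain ⟨U, L, hs⟩ := hP.exists_sides r.dir r.level
  rw [visible_iff, coord_pt, coord_perp_pt, mem_line, mem_extension_iff hcl]
  refine and_congr_right fun htP => ⟨fun hp => ?_, fun ht => ?_⟩
  · have hagree : Agree U L a t := by
      by_contra hcon
      obtain ⟨t', ht', -, hp'⟩ :=
        hs.exists_passages_of_not_agree hcl (hr (mem_image_of_mem _ ha)) hcon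
      refine hp (hp'.mono (sdiff_subset.trans ?_))
      rw [segment_eq_uIcc, segment_eq_uIcc]
      exact uIcc_subset_uIcc_left ht'
    rw [← mem_line, hs.line_eq] at htP
    rw [hs.line_eq, hs.line_interior] at hp ⊢
    exact mem_lineExtension_of_not_passages hs.tame_above hs.tame_below ha htP hagree hp
  · exact not_passages_of_mem_lineExtension (isClosed_line hcl _ _)
      (isOpen_line isOpen_interior _ _) line_interior_subset (Nat.succ_pos _)
      (carrier_subset_iff.1 (hr.trans sdiff_subset)) ha ht

end Visible

/-! ### Slices -/

section Slices

variable {P σ : Set (ℝ × ℝ)} {k : ℕ} {d : Dir} {rep : Dir → Set (ℝ × ℝ) → Seg} {g r s : Seg}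
  {p z w : ℝ × ℝ} {t : ℝ}

lemma IsSlice.subset_cutInterior (hσ : IsSlice P k d σ) : σ ⊆ cutInterior P k d := by
  obtain ⟨z, -, rfl⟩ := hσ
  exact connectedComponentIn_subset _ _

lemma IsSlice.isPreconnected (hσ : IsSlice P k d σ) : IsPreconnected σ := by
  obtain ⟨z, -, rfl⟩ := hσ
  exact isPreconnected_connectedComponentIn

lemma IsSlice.visible_iff (hP : IsRectangleUnion P) (hσ : IsSlice P k d σ) (hz : z ∈ σ)
    (hw : w ∈ σ) (t : ℝ) : Visible P k d z t ↔ Visible P k d w t := by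
  refine hσ.isPreconnected.induction₂ (fun z w => ∀ t, Visible P k d z t ↔ Visible P k d w t)
    (fun z hz => ?_) (fun x y z _ _ _ hxy hyz t => (hxy t).trans (hyz t))
    (fun x y _ _ hxy t => (hxy t).symm) hz hw t
  have hev := eventually_visible_iff hP (hσ.subset_cutInterior hz)
  exact (hev.filter_mono nhdsWithin_le_nhds).mono fun w hw t => (hw t).symm

lemma IsSlice.uIcc_subset_line (hP : IsRectangleUnion P) (hσ : IsSlice P k d σ) (hz : z ∈ σ)
    (hw : w ∈ σ) (ht : Visible P k d z t) :
    uIcc (coord d.perp z) (coord d.perp w) ⊆ line P d.perp t := by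
  intro y hy
  have hlevels := hσ.isPreconnected.image _ (continuous_coord d.perp).continuousOn
  obtain ⟨v, hv, rfl⟩ :=
    hlevels.ordConnected.uIcc_subset (mem_image_of_mem _ hz) (mem_image_of_mem _ hw) hy
  rw [mem_line, pt_perp]
  exact ((hσ.visible_iff hP hz hv t).1 ht).1

lemma Seg.pt_lo_mem_carrier (s : Seg) : pt s.dir s.level s.lo ∈ s.carrier :=
  mem_image_of_mem _ (left_mem_Icc.2 s.lo_lt_hi.le)

lemma IsSelection.uIcc_level_subset_line (hP : IsRectangleUnion P) (hrep : IsSelection P k rep)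
    (hσ : IsSlice P k d σ) (hp : p ∈ σ) (ht : Visible P k d p t) :
    uIcc (coord d.perp p) (rep d σ).level ⊆ line P d.perp t := by
  obtain ⟨hd, hsub⟩ := hrep d σ hσ
  simpa only [hd, coord_perp_pt] using
    hσ.uIcc_subset_line hP hp (hsub (rep d σ).pt_lo_mem_carrier) ht

lemma IsSelection.visible_iff_mem_extension (hP : IsRectangleUnion P) (hrep : IsSelection P k rep)
    (hσ : IsSlice P k d σ) (hp : p ∈ σ) : Visible P k d p t ↔
      pt d (rep d σ).level t ∈ P ∧ pt d (rep d σ).level t ∈ extension P k (rep d σ) := by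
  obtain ⟨hd, hsub⟩ := hrep d σ hσ
  generalize rep d σ = r at *
  subst hd
  rw [hσ.visible_iff hP hp (hsub r.pt_lo_mem_carrier) t,
    SlidingTransmitter.visible_iff_mem_extension hP (hsub.trans hσ.subset_cutInterior)
      r.pt_lo_mem_carrier]

lemma carrier_inter_extension_nonempty_iff (hr : r.dir = s.dir.perp) :
    (s.carrier ∩ extension P k r).Nonempty ↔
      r.level ∈ Icc s.lo s.hi ∧ pt s.dir s.level r.level ∈ extension P k r := by
  constructor
  · rintro ⟨_, ⟨t, ht, rfl⟩, hext⟩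
    have htr := level_eq_of_mem_extension hext
    rw [hr, Dir.perp_perp, coord_pt] at htr
    exact htr ▸ ⟨ht, hext⟩
  · exact fun ⟨hmem, hext⟩ => ⟨_, mem_image_of_mem _ hmem, hext⟩

lemma isGuardSegment_iff : IsGuardSegment P g ↔
    (∃ e, IsEdge P e ∧ e.carrier ⊆ g.carrier) ∧ IsMaxIcc (line P g.dir g.level) g.lo g.hi :=
  and_congr_right' maximal_carrier_iff

lemma IsGuardSegment.isTransmitter (hg : IsGuardSegment P g) : IsTransmitter P g := hg.2.1

lemma IsGuardSegment.sees_iff_of_mem_slice (hP : IsRectangleUnion P) (hrep : IsSelection P k rep)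
    (hg : IsGuardSegment P g) (hσ : IsSlice P k g.dir.perp σ) (hp : p ∈ σ) :
    Sees P k g p ↔ (g.carrier ∩ extension P k (rep g.dir.perp σ)).Nonempty := by
  have hiff : Visible P k g.dir.perp p g.level →
      (coord g.dir p ∈ Icc g.lo g.hi ↔ (rep g.dir.perp σ).level ∈ Icc g.lo g.hi) := fun hv => by
    have hline := hrep.uIcc_level_subset_line hP hσ hp hv
    rw [Dir.perp_perp] at hline
    have hmax := (isGuardSegment_iff.1 hg).2
    exact ⟨fun h => hmax.mem_of_uIcc_subset h hline,
      fun h => hmax.mem_of_uIcc_subset h (by rwa [uIcc_comm])⟩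
  rw [sees_iff hg.isTransmitter, and_congr_left hiff,
    carrier_inter_extension_nonempty_iff (hrep _ _ hσ).1]
  refine and_congr_right fun hmem => ?_
  rw [hrep.visible_iff_mem_extension hP hσ hp, pt_perp]
  exact and_iff_right (hg.isTransmitter (mem_image_of_mem _ hmem))

lemma Cross.hitBy_iff_sees {c : Cross P k rep} (hP : IsRectangleUnion P)
    (hrep : IsSelection P k rep) (hg : IsGuardSegment P g) (hp : p ∈ c.slice g.dir.perp) :
    c.HitBy g ↔ Sees P k g p :=
  (hg.sees_iff_of_mem_slice hP hrep (c.isSlice _) hp).symm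

lemma IsSelection.exists_cross (hP : IsRectangleUnion P) (hrep : IsSelection P k rep)
    (hp : ∀ d, p ∈ cutInterior P k d) : ∃ c : Cross P k rep, ∀ d, p ∈ c.slice d := by
  let σ d := connectedComponentIn (cutInterior P k d) p
  have hσ : ∀ d, IsSlice P k d (σ d) := fun d => ⟨p, hp d, rfl⟩
  have hpσ : ∀ d, p ∈ σ d := fun d => mem_connectedComponentIn (hp d)
  have hpP : p ∈ P := interior_subset (hp .horizontal).1
  have hmem : ∀ d, pt d (rep d (σ d)).level (rep d.perp (σ d.perp)).level ∈
      extension P k (rep d (σ d)) := fun d => by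
    have hline := hrep.uIcc_level_subset_line hP (hσ d.perp) (hpσ d.perp) (visible_self hpP)
    rw [Dir.perp_perp] at hline
    exact ((hrep.visible_iff_mem_extension hP (hσ d) (hpσ d)).1
      ((visible_self hpP).move hline)).2
  refine ⟨⟨σ, hσ, ⟨p, hpσ _, hpσ _⟩, pt .horizontal (rep .horizontal (σ .horizontal)).level
    (rep .vertical (σ .vertical)).level, ?_⟩, hpσ⟩
  rintro (_ | _)
  exacts [hmem .horizontal, hmem .vertical]

lemma Cross.exists_mem_slice (c : Cross P k rep) : ∃ p ∈ P, ∀ d, p ∈ c.slice d := by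
  obtain ⟨p, hH, hV⟩ := c.pixel_nonempty
  refine ⟨p, interior_subset ((c.isSlice _).subset_cutInterior hH).1, ?_⟩
  rintro (_ | _)
  exacts [hH, hV]

end Slices

/-! ### Density of the pixels -/

section Density

variable {P : Set (ℝ × ℝ)} {k : ℕ} {d : Dir} {c : ℝ} {p : ℝ × ℝ}

lemma Tame.frequently_mem_interior {S : Set ℝ} {t : ℝ} (hS : Tame S) (ht : t ∈ S) :
    ∃ᶠ u in 𝓝[≠] t, u ∈ interior S := by
  rcases hS.eventually_or_eventually_of_mem ht with h | h
  · exact (eventually_mem_interior isOpen_Ioi h).frequently.filter_mono (nhdsGT_le_nhdsNE t)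
  · exact (eventually_mem_interior isOpen_Iio h).frequently.filter_mono (nhdsLT_le_nhdsNE t)

lemma Sides.level_ne_of_isEdge {S : Set ℝ} {e : Seg} (hs : Sides P e.dir c S S) (hP : IsClosed P)
    (he : IsEdge P e) : e.level ≠ c := by
  rintro rfl
  have hsub : Icc e.lo e.hi ⊆ frontier S := by
    have hbdry : bdry S S = frontier S := by
      rw [bdry, union_self, inter_self, hs.tame_above.isCompact.isClosed.frontier_eq]
    rw [← hbdry, ← hs.line_frontier hP]
    exact carrier_subset_iff.1 he.1
  have hempty : Ioo e.lo e.hi ⊆ ∅ := by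
    rw [← interior_frontier hs.tame_above.isCompact.isClosed]
    exact interior_maximal (Ioo_subset_Icc_self.trans hsub) isOpen_Ioo
  exact (nonempty_Ioo.2 e.lo_lt_hi).ne_empty (subset_empty_iff.1 hempty)

lemma mem_cutInterior_of_forall_level_ne (hp : p ∈ interior P)
    (h : ∀ e, IsEdge P e → e.dir = d → e.level ≠ coord d.perp p) : p ∈ cutInterior P k d := by
  refine ⟨hp, fun hmem => ?_⟩
  obtain ⟨e, ⟨he, rfl⟩, hext⟩ := mem_iUnion₂.1 hmem
  exact h e he rfl (level_eq_of_mem_extension hext).symm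

namespace IsRectangleUnion

lemma eventually_level_ne (hP : IsRectangleUnion P) (d : Dir) (c : ℝ) :
    ∀ᶠ c' in 𝓝[≠] c, ∀ e, IsEdge P e → e.dir = d → e.level ≠ c' := by
  obtain ⟨U, L, hs⟩ := hP.exists_sides d c
  rw [← nhdsLT_sup_nhdsGT, eventually_sup]
  constructor
  · filter_upwards [hs.eventually_below] with c' hs' e he hd
    exact (hd ▸ hs').level_ne_of_isEdge hP.isCompact.isClosed he
  · filter_upwards [hs.eventually_above] with c' hs' e he hd
    exact (hd ▸ hs').level_ne_of_isEdge hP.isCompact.isClosed he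

lemma frequently_mem_interior {t : ℝ} (hP : IsRectangleUnion P) (hp : pt d c t ∈ P) :
    ∃ᶠ c' in 𝓝[≠] c, ∃ᶠ t' in 𝓝[≠] t, pt d c' t' ∈ interior P := by
  have hinterior : ∀ {S : Set ℝ} {c' : ℝ}, Sides P d c' S S → t ∈ S →
      ∃ᶠ t' in 𝓝[≠] t, pt d c' t' ∈ interior P := fun hs ht => by
    simpa only [← mem_line, hs.line_interior, inter_self]
      using hs.tame_above.frequently_mem_interior ht
  obtain ⟨U, L, hs⟩ := hP.exists_sides d c
  rw [← mem_line, hs.line_eq] at hp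
  rcases hp with ht | ht
  · exact (hs.eventually_above.mono fun _ hs' => hinterior hs' ht).frequently.filter_mono
      (nhdsGT_le_nhdsNE c)
  · exact (hs.eventually_below.mono fun _ hs' => hinterior hs' ht).frequently.filter_mono
      (nhdsLT_le_nhdsNE c)

lemma subset_closure_cutInterior (hP : IsRectangleUnion P) (k : ℕ) :
    P ⊆ closure {p | ∀ d, p ∈ cutInterior P k d} := by
  rintro ⟨t, c⟩ hp
  refine mem_closure_iff_frequently.2 fun hcon => ?_
  have hswap : Tendsto (pt .horizontal).uncurry (𝓝[≠] c ×ˢ 𝓝[≠] t) (𝓝 (t, c)) := by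
    refine ((continuous_pt .horizontal).tendsto (c, t)).mono_left ?_
    rw [nhds_prod_eq]
    exact prod_mono nhdsWithin_le_nhds nhdsWithin_le_nhds
  have hfreq : ∃ᶠ c' in 𝓝[≠] c, ∃ᶠ t' in 𝓝[≠] t, pt .horizontal c' t' ∈ interior P :=
    hP.frequently_mem_interior hp
  obtain ⟨c', hfreq', hnot, hc'⟩ := (hfreq.and_eventually
    ((hswap.eventually hcon).curry.and (hP.eventually_level_ne .horizontal c))).exists
  obtain ⟨t', hint, hnot', ht'⟩ := (hfreq'.and_eventually
    (hnot.and (hP.eventually_level_ne .vertical t))).exists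
  refine hnot' ?_
  rintro (_ | _)
  exacts [mem_cutInterior_of_forall_level_ne hint hc', mem_cutInterior_of_forall_level_ne hint ht']

end IsRectangleUnion

end Density

/-! ### Shifting a transmitter to a guard-segment -/

section Shift

variable {P : Set (ℝ × ℝ)} {d : Dir} {c a b a' b' : ℝ} {s : Seg}

lemma Sides.exists_Icc_subset_frontier {U L : Set ℝ} (hs : Sides P d c U L) (hP : IsClosed P)
    (hab : a < b) (hsub : Icc a b ⊆ line P d c) (hL : ¬ Icc a b ⊆ L) :
    ∃ a' b', a' < b' ∧ Icc a' b' ⊆ Icc a b ∩ line (frontier P) d c := by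
  have hLcl : IsClosed L := hs.tame_below.isCompact.isClosed
  have hopen : IsOpen (Ioo a b \ L) := isOpen_Ioo.sdiff hLcl
  obtain ⟨t, ht⟩ : (Ioo a b \ L).Nonempty := sdiff_nonempty.2 fun hIoo =>
    hL (closure_Ioo hab.ne ▸ closure_minimal hIoo hLcl)
  obtain ⟨a', b', -, hnhds, hIcc⟩ := exists_Icc_mem_subset_of_mem_nhds (hopen.mem_nhds ht)
  obtain ⟨hat, htb⟩ := Icc_mem_nhds_iff.1 hnhds
  refine ⟨a', b', hat.trans htb, fun x hx => ?_⟩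
  have hxab : x ∈ Icc a b := Ioo_subset_Icc_self (hIcc hx).1
  refine ⟨hxab, ?_⟩
  rw [hs.line_frontier hP]
  exact ⟨hs.line_eq ▸ hsub hxab, fun hint => (hIcc hx).2 (interior_subset hint.2)⟩

lemma exists_isGuardSegment_of_Icc_subset_frontier (hP : IsCompact P)
    (hsub : Icc a b ⊆ line P d c) (hab' : a' < b')
    (hfr : Icc a' b' ⊆ Icc a b ∩ line (frontier P) d c) :
    ∃ g, IsGuardSegment P g ∧ g.dir = d ∧ g.level = c ∧ Icc a b ⊆ Icc g.lo g.hi := by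
  have hfrP : frontier P ⊆ P := hP.isClosed.frontier_subset
  obtain ⟨elo, ehi, hedge, he⟩ := exists_isMaxIcc
    (isCompact_line (hP.of_isClosed_subset isClosed_frontier hfrP) d c) hab'.le
    (hfr.trans inter_subset_right)
  have ha' : a' ∈ Icc a b := (hfr (left_mem_Icc.2 hab'.le)).1
  obtain ⟨glo, ghi, hguard, hg⟩ := exists_isMaxIcc (isCompact_line hP d c)
    (ha'.1.trans ha'.2) hsub
  have hea' : a' ∈ Icc elo ehi := he (left_mem_Icc.2 hab'.le)
  have heg : Icc elo ehi ⊆ Icc glo ghi := fun y hy => hguard.mem_of_uIcc_subset (hg ha')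
    (((ordConnected_Icc.uIcc_subset hea' hy).trans hedge.1).trans (preimage_mono hfrP))
  have hlt : elo < ehi := (hea'.1.trans_lt hab').trans_le (he (right_mem_Icc.2 hab'.le)).2
  obtain ⟨hlo, hhi⟩ := (Icc_subset_Icc_iff hlt.le).1 heg
  exact ⟨⟨d, c, glo, ghi, hlo.trans_lt (hlt.trans_le hhi)⟩, isGuardSegment_iff.2
    ⟨⟨⟨d, c, elo, ehi, hlt⟩, isEdge_iff.2 hedge, image_mono heg⟩, hguard⟩, rfl, rfl, hg⟩

lemma IsRectangleUnion.exists_shift (hP : IsRectangleUnion P) (hab : a < b)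
    (hsub : Icc a b ⊆ line P d c) :
    ∃ c' U L, Sides P d c' U L ∧ ¬ Icc a b ⊆ L ∧ ∀ x ∈ uIcc c c', Icc a b ⊆ line P d x := by
  have hcl := hP.isCompact.isClosed
  let K : Set ℝ := ⋂ t ∈ Icc a b, line P d.perp t
  have hK : ∀ x, x ∈ K ↔ Icc a b ⊆ line P d x := fun x => by
    simp only [K, mem_iInter, mem_line, pt_perp]
    rfl
  have hKcomp : IsCompact K := (isCompact_line hP.isCompact d.perp a).of_isClosed_subset
    (isClosed_biInter fun t _ => isClosed_line hcl d.perp t)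
    (biInter_subset_of_mem (left_mem_Icc.2 hab.le))
  obtain ⟨c', c'', hmax, hc⟩ := exists_isMaxIcc hKcomp le_rfl
    ((Icc_self c).symm ▸ singleton_subset_iff.2 ((hK c).2 hsub))
  obtain ⟨hc'c, hcc''⟩ : c ∈ Icc c' c'' := hc (left_mem_Icc.2 le_rfl)
  obtain ⟨U, L, hs⟩ := hP.exists_sides d c'
  refine ⟨c', U, L, hs, fun hL => ?_, fun x hx => ?_⟩
  · have hbelow : ∀ᶠ x in 𝓝[<] c', x ∈ K :=
      hs.isStepAt.below.mono fun x hx => (hK x).2 (hx ▸ hL)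
    obtain ⟨l, hl, hlK⟩ := mem_nhdsLT_iff_exists_Ico_subset.1 hbelow
    refine (show l < c' from hl).ne (hmax.2 l c'' (le_of_lt hl) le_rfl ?_).1
    rw [← Ico_union_Icc_eq_Icc (le_of_lt hl) (hc'c.trans hcc'')]
    exact union_subset hlK hmax.1
  · rw [uIcc_of_ge hc'c] at hx
    exact (hK x).1 (hmax.1 ⟨hx.1, hx.2.trans hcc''⟩)

lemma IsTransmitter.exists_isGuardSegment_forall_sees {k : ℕ} (hP : IsRectangleUnion P)
    (hs : IsTransmitter P s) :
    ∃ g, IsGuardSegment P g ∧ ∀ p, Sees P k s p → Sees P k g p := by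
  obtain ⟨c, U, L, hsides, hL, hshift⟩ := hP.exists_shift s.lo_lt_hi (carrier_subset_iff.1 hs)
  have hsub : Icc s.lo s.hi ⊆ line P s.dir c := hshift c right_mem_uIcc
  obtain ⟨a', b', hab', hfr⟩ :=
    hsides.exists_Icc_subset_frontier hP.isCompact.isClosed s.lo_lt_hi hsub hL
  obtain ⟨g, hg, hdir, rfl, hIcc⟩ :=
    exists_isGuardSegment_of_Icc_subset_frontier hP.isCompact hsub hab' hfr
  refine ⟨g, hg, fun p hp => ?_⟩
  rw [sees_iff hs] at hp
  rw [sees_iff hg.isTransmitter, hdir]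
  refine ⟨hIcc hp.1, hp.2.move fun x hx => ?_⟩
  rw [Dir.perp_perp, mem_line, pt_perp]
  exact hshift x hx hp.1

end Shift

/-! ### Transmitters and guard-segments -/

section Guards

variable {P : Set (ℝ × ℝ)} {k : ℕ} {rep : Dir → Set (ℝ × ℝ) → Seg} {S : Finset Seg}

lemma Guards.exists_isGuardSegment (hP : IsRectangleUnion P)
    (hS : ∀ s ∈ S, IsTransmitter P s) (hguard : Guards P k S) :
    ∃ S' : Finset Seg, S'.card ≤ S.card ∧ (∀ g ∈ S', IsGuardSegment P g) ∧ Guards P k S' := by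
  classical
  choose! G hG hsees using fun s hs =>
    (hS s hs).exists_isGuardSegment_forall_sees (k := k) hP
  refine ⟨S.image G, Finset.card_image_le, Finset.forall_mem_image.2 hG, fun p hp => ?_⟩
  obtain ⟨s, hs, hsp⟩ := hguard p hp
  exact ⟨G s, Finset.mem_image_of_mem G hs, hsees s hs p hsp⟩

lemma isClosed_setOf_exists_sees (hP : IsClosed P) (k : ℕ) (S : Finset Seg) :
    IsClosed {p | ∃ s ∈ S, Sees P k s p} := by
  have hunion : {p | ∃ s ∈ S, Sees P k s p} = ⋃ s ∈ S, {p | Sees P k s p} := by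
    ext p
    simp
  rw [hunion]
  exact S.finite_toSet.isClosed_biUnion fun s _ => isClosed_setOf_sees hP k s

lemma guards_iff_forall_hitBy (hP : IsRectangleUnion P) (hrep : IsSelection P k rep)
    (hS : ∀ g ∈ S, IsGuardSegment P g) :
    Guards P k S ↔ ∀ c : Cross P k rep, ∃ g ∈ S, c.HitBy g := by
  constructor
  · intro hguard c
    obtain ⟨p, hp, hpc⟩ := c.exists_mem_slice
    obtain ⟨g, hg, hsee⟩ := hguard p hp
    exact ⟨g, hg, (Cross.hitBy_iff_sees hP hrep (hS g hg) (hpc _)).2 hsee⟩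
  · intro hhit
    suffices hdense : {p | ∀ d, p ∈ cutInterior P k d} ⊆ {p | ∃ g ∈ S, Sees P k g p} from
      (hP.subset_closure_cutInterior k).trans
        (closure_minimal hdense (isClosed_setOf_exists_sees hP.isCompact.isClosed k S))
    intro p hp
    obtain ⟨c, hpc⟩ := hrep.exists_cross hP hp
    obtain ⟨g, hg, hgc⟩ := hhit c
    exact ⟨g, hg, (Cross.hitBy_iff_sees hP hrep (hS g hg) (hpc _)).1 hgc⟩

end Guards

end SlidingTransmitter

open SlidingTransmitter in
theorem mainTheorem3_general {P : Set (ℝ × ℝ)} (hP : IsRectangleUnion P) {k : ℕ} (m : ℕ)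
    {rep : Dir → Set (ℝ × ℝ) → Seg} (hrep : IsSelection P k rep) :
    (∃ S : Finset Seg, S.card ≤ m ∧ (∀ s ∈ S, IsTransmitter P s) ∧ Guards P k S) ↔
      ∃ S' : Finset Seg, S'.card ≤ m ∧ (∀ g ∈ S', IsGuardSegment P g) ∧
        ∀ c : Cross P k rep, ∃ g ∈ S', c.HitBy g := by
  constructor
  · rintro ⟨S, hcard, hS, hguard⟩
    obtain ⟨S', hcard', hS', hguard'⟩ := hguard.exists_isGuardSegment hP hS
    exact ⟨S', hcard'.trans hcard, hS', (guards_iff_forall_hitBy hP hrep hS').1 hguard'⟩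
  · rintro ⟨S', hcard, hS', hhit⟩
    exact ⟨S', hcard, fun g hg => (hS' g hg).isTransmitter,
      (guards_iff_forall_hitBy hP hrep hS').2 hhit⟩

theorem mainTheorem3 (P : Set (ℝ × ℝ)) (hP : SlidingTransmitter.IsOrthogonalPolygon P) (k m : ℕ)
    (rep : SlidingTransmitter.Dir → Set (ℝ × ℝ) → SlidingTransmitter.Seg)
    (hrep : SlidingTransmitter.IsSelection P k rep) :
    (∃ S : Finset SlidingTransmitter.Seg, S.card ≤ m ∧
        (∀ s ∈ S, SlidingTransmitter.IsTransmitter P s) ∧ SlidingTransmitter.Guards P k S) ↔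
      ∃ S' : Finset SlidingTransmitter.Seg, S'.card ≤ m ∧
        (∀ g ∈ S', SlidingTransmitter.IsGuardSegment P g) ∧
        ∀ c : SlidingTransmitter.Cross P k rep, ∃ g ∈ S', c.HitBy g :=
  mainTheorem3_general hP.finite_union m hrep
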